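/- Let $\sigma_1,\delta,\kappa,\rho>0$ and $\sigma_2,\lambda\ge 0$, and let $c:[0,\infty)\to[0,\infty)$ be strictly increasing and strictly convex, continuously differentiable on $[0,\infty)$ and twice continuously differentiable on $(0,\infty)$, with $c'(h)\to\infty$ as $h\to\infty$. Let $(c')^{-1}(x)$ be the unique $h\ge 0$ with $c'(h)=x$ if $x\ge c'(0)$, and $(c')^{-1}(x):=0$ if $x<c'(0)$; let $\hat h(x)$ be the unique maximizer of $h\mapsto hx-c(h)$ over $h\in[0,\infty)$. Put $$a_1=\frac{-\delta\rho+\sqrt{\delta^2\rho^2+4\kappa\rho}}{4},\quad a_3=\frac{2a_1\rho}{\delta\rho+\lambda\rho+2a_1},\quad a_2=\frac{a_3(2\rho-a_3)}{2\rho(2\lambda+\delta)},\quad \bar a=a_3-a_2(2\lambda+\delta),\quad L_v=\frac{\bar a}{\delta},$$ $$\gamma_\infty^0=-\lambda\sigma_1^2+\sqrt{\lambda^2\sigma_1^4+\sigma_1^2\sigma_2^2},\qquad f(\gamma,h)=-(\sigma_1^{-2}+h)\gamma^2-2\lambda\gamma+\sigma_2^2 .$$ For $\gamma_{\max}>\gamma_\infty^0$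 let $v_{\gamma_{\max}}$ be the value function of the reduced control problem of information acquisition, $$v_{\gamma_{\max}}(\gamma)=\inf_h\int_0^\infty e^{-\delta t}\bigl(\bar a\,\gamma_t^{h}+c(h_t)\bigr)\,dt,\qquad \gamma\in[0,\gamma_{\max}],$$ where the infimum is over all Borel functions $h:[0,\infty)\to[0,(c')^{-1}(\gamma_{\max}^2L_v)]$ and $\gamma^{h}$ is the absolutely continuous solution of $\dot\gamma^h_t=f(\gamma^h_t,h_t)$ for a.e. $t\ge0$, $\gamma^h_0=\gamma$. Then $v_{\gamma_{\max}}(\gamma)$ is the same for all $\gamma_{\max}>\gamma_\infty^0$ with $\gamma_{\max}\ge\gamma$; hence there is a function $v$ on $[0,\infty)$ with $v=v_{\gamma_{\max}}$ on $[0,\gamma_{\max}]$ for all $\gamma_{\max}>\gamma_\infty^0$. The function $v$ is differentiable on $[0,\infty)$ (from the right at $0$), and the feedback map $H^*(\gamma):=\hat h\bigl(\gamma^2v'(\gamma)\bigr)$, $\gamma\ge 0$, satisfies $$0\le H^*(\gamma)\le\hat h(\gamma^2L_v)\le (c')^{-1}(\gamma^2L_v)\qquad\text{for all }\gamma\in[0,\infty).$$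 If, moreover, $c(x)=\zeta x^2$ for all $x\ge 0$ and some $\zeta>0$, then $$\lim_{\gamma\to\infty}\frac{H^*(\gamma)}{\gamma^{1/2}}=\frac{\sqrt{\bar a}}{\sqrt\zeta}.$$ -/

import Mathlib

open Set Filter Topology MeasureTheory

noncomputable section

namespace InfoAcq

/-- Coefficients of the model: volatilities `σ₁ > 0` and `σ₂ ≥ 0` of the state and of the hidden
drift, speed of mean reversion `lam ≥ 0`, discount factor `δ > 0`, and cost coefficients
`κ, ρ > 0` for the state and the state control. -/
structure Params where
  σ₁ : ℝ
  σ₂ : ℝ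
  lam : ℝ
  δ : ℝ
  κ : ℝ
  ρ : ℝ
  σ₁_pos : 0 < σ₁
  σ₂_nonneg : 0 ≤ σ₂
  lam_nonneg : 0 ≤ lam
  δ_pos : 0 < δ
  κ_pos : 0 < κ
  ρ_pos : 0 < ρ

/-- The marginal cost `c'` of a cost function `c` on `[0, ∞)`, one-sided at `0`. -/
def marginalCost (c : ℝ → ℝ) (h : ℝ) : ℝ := derivWithin c (Ici 0) h

/-- Admissible costs of information acquisition `c : [0, ∞) → [0, ∞)`; only the restriction of
`c` to `[0, ∞)` matters. Two derivatives are asked for on `(0, ∞)` and one up to `0`, so that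
`ζ x ^ (1 + ε)` is included for all `ζ, ε > 0`. The marginal cost is unbounded, so that
`(c')⁻¹` is defined on all of `[c' 0, ∞)`. -/
structure IsInformationCost (c : ℝ → ℝ) : Prop where
  nonneg : ∀ x, 0 ≤ x → 0 ≤ c x
  strictConvexOn : StrictConvexOn ℝ (Ici 0) c
  strictMonoOn : StrictMonoOn c (Ici 0)
  contDiffOn_one : ContDiffOn ℝ 1 c (Ici 0)
  contDiffOn_two : ContDiffOn ℝ 2 c (Ioi 0)
  tendsto_marginalCost : Tendsto (marginalCost c) atTop atTop

/-- The inverse `(c')⁻¹` of the strictly increasing marginal cost: for `x` in the range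
`[c' 0, ∞)` of `c'` this is the unique `h ≥ 0` with `c' h = x`; below the range it is `0`. -/
def marginalCostInv (c : ℝ → ℝ) (x : ℝ) : ℝ := sInf {h : ℝ | 0 ≤ h ∧ x ≤ marginalCost c h}

/-- `ĥ x`, the (unique) maximizer of `h ↦ h x - c h` over `h ≥ 0`, written as the supremum of the
one-point set of maximizers. -/
def hHat (c : ℝ → ℝ) (x : ℝ) : ℝ :=
  sSup {h : ℝ | 0 ≤ h ∧ IsMaxOn (fun y => y * x - c y) (Ici 0) h}

namespace Params

variable (P : Params)

def a₁ : ℝ := -(P.δ * P.ρ) / 4 + √(P.δ ^ 2 * P.ρ ^ 2 + 4 * P.κ * P.ρ) / 4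

def a₃ : ℝ := 2 * P.a₁ * P.ρ / (P.δ * P.ρ + P.lam * P.ρ + 2 * P.a₁)

def a₂ : ℝ := P.a₃ * (2 * P.ρ - P.a₃) / (2 * P.ρ * (2 * P.lam + P.δ))

/-- The running-cost coefficient `ā` of the reduced problem. -/
def aBar : ℝ := P.a₃ - P.a₂ * (2 * P.lam + P.δ)

/-- The constant `L_v`. -/
def Lv : ℝ := P.aBar / P.δ

/-- The equilibrium of the uncontrolled conditional variance. -/
def gammaInfty : ℝ :=
  -(P.lam * P.σ₁ ^ 2) + √(P.lam ^ 2 * P.σ₁ ^ 4 + P.σ₁ ^ 2 * P.σ₂ ^ 2)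

/-- The drift of the conditional variance. -/
def drift (γ h : ℝ) : ℝ := -((1 / P.σ₁) ^ 2 + h) * γ ^ 2 - 2 * P.lam * γ + P.σ₂ ^ 2

/-- The largest information acquisition rate in the problem on `[0, γmax]`. -/
def hMax (c : ℝ → ℝ) (γmax : ℝ) : ℝ := marginalCostInv c (γmax ^ 2 * P.Lv)

/-- Controls of the reduced problem on `[0, γmax]`: Borel functions of time `t ≥ 0` with values
in `[0, hMax]`. -/
def IsControl (c : ℝ → ℝ) (γmax : ℝ) (h : ℝ → ℝ) : Prop :=
  Measurable h ∧ ∀ t, 0 ≤ t → h t ∈ Icc 0 (P.hMax c γmax)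

/-- `g` is the (absolutely continuous) solution on `[0, ∞)` of `g' = drift g h` a.e., `g 0 = γ₀`,
in integrated form. -/
def IsTrajectory (h : ℝ → ℝ) (γ₀ : ℝ) (g : ℝ → ℝ) : Prop :=
  ContinuousOn g (Ici 0) ∧
    ∀ t, 0 ≤ t → g t = γ₀ + ∫ s in (0 : ℝ)..t, P.drift (g s) (h s)

/-- Discounted cost of a control `h` with conditional variance `g`. -/
def cost (c : ℝ → ℝ) (h g : ℝ → ℝ) : ℝ :=
  ∫ t in Ioi (0 : ℝ), Real.exp (-P.δ * t) * (P.aBar * g t + c (h t))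

/-- The value function of the reduced problem on `[0, γmax]`. -/
def reducedValue (c : ℝ → ℝ) (γmax γ₀ : ℝ) : ℝ :=
  sInf {J : ℝ | ∃ h g : ℝ → ℝ,
    P.IsControl c γmax h ∧ P.IsTrajectory h γ₀ g ∧ J = P.cost c h g}

/-- The value function `v` on `[0, ∞)`: at `γ` it is the value function of a reduced problem
whose upper bound exceeds both `γ` and `gammaInfty`. The choice of the bound is immaterial;
this is part of the main theorem. -/
def value (c : ℝ → ℝ) (γ : ℝ) : ℝ := P.reducedValue c (max γ P.gammaInfty + 1) γ

/-- The feedback map `H*` on `[0, ∞)`, with the right derivative of `v` at `0`. -/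
def feedback (c : ℝ → ℝ) (γ : ℝ) : ℝ :=
  hHat c (γ ^ 2 * derivWithin (P.value c) (Ici 0) γ)

end Params

end InfoAcq

end

/-! Everything is proved for one function `V = freeValue`, the infimum over all bounded Borel
controls. It equals every `reducedValue`, because cutting a control at `hMax` is free. The lower
control gives a larger variance, and `aBar = δ * Lv` lets one integrate the discounted excess by
parts. The excess then costs at most `Lv * γmax ^ 2` per unit of removed control, while `c'` is at
least `γmax ^ 2 * Lv` above `hMax` (`cost_min_le`).

Differentiability comes from two opposite curvature properties. For a fixed control the drift is
concave in the state, so `V` is concave in `γ`. The precision `u = 1 / γ` solves `u' = σ₁⁻² + h + 2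
λ u - σ₂² u²`, which is concave in `(u, h)` jointly, while `aBar / u` is decreasing and convex;
hence `V` is convex in `u`. Concavity in `γ` excludes convex kinks, convexity in `1 / γ` excludes
concave ones. At `0` the slopes are monotone and bounded.

Trajectories with the same control never drift apart, since the drift decreases in the state. So `V`
has slopes between `0` and `aBar / δ = Lv`. Monotonicity of `hHat` and its bound by
`marginalCostInv` then give the estimates on the feedback.

Since `V` is differentiable, dynamic programming yields the Hamilton-Jacobi-Bellman equation
pointwise. For `c = ζ x²`, with `p = V'`, dividing by `γ` gives `γ (γ p)² / (4 ζ) = aBar - σ₁⁻² γ p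
- 2 λ p + σ₂² p / γ - δ V / γ`. Boundedness of the left side forces `γ p → 0`, hence `p → 0`, and `V
/ γ → 0` by concavity. So the left side tends to `aBar`, and its square root divided by `√ζ` is the
ratio in question. -/

noncomputable section
namespace InfoAcq

/-! ### Calculus of absolutely continuous functions and Gronwall comparison. -/

/-- `g` is a primitive on `[0, ∞)` of the locally bounded function `φ`. -/
structure HasRate (g φ : ℝ → ℝ) : Prop where
  intervalIntegrable : ∀ t, 0 ≤ t → IntervalIntegrable φ volume 0 t
  bounded : ∀ T, ∃ C, ∀ s ∈ Icc 0 T, |φ s| ≤ C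
  eq : ∀ t, 0 ≤ t → g t = g 0 + ∫ s in (0 : ℝ)..t, φ s

namespace HasRate

variable {f g φ ψ : ℝ → ℝ}

lemma intervalIntegrable' (hg : HasRate g φ) {s t : ℝ} (hs : 0 ≤ s) (ht : 0 ≤ t) :
    IntervalIntegrable φ volume s t :=
  (hg.intervalIntegrable s hs).symm.trans (hg.intervalIntegrable t ht)

lemma sub_eq (hg : HasRate g φ) {s t : ℝ} (hs : 0 ≤ s) (ht : 0 ≤ t) :
    g t - g s = ∫ r in s..t, φ r := by
  rw [hg.eq t ht, hg.eq s hs, add_sub_add_left_eq_sub]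
  exact intervalIntegral.integral_interval_sub_left (hg.intervalIntegrable t ht)
    (hg.intervalIntegrable s hs)

lemma exists_lipschitz (hg : HasRate g φ) (T : ℝ) :
    ∃ C, 0 ≤ C ∧ (∀ s ∈ Icc 0 T, |φ s| ≤ C) ∧
      ∀ s ∈ Icc 0 T, ∀ t ∈ Icc 0 T, |g t - g s| ≤ C * |t - s| := by
  obtain ⟨C, hC⟩ := hg.bounded T
  refine ⟨max C 0, le_max_right _ _, fun s hs => (hC s hs).trans (le_max_left _ _),
    fun s hs t ht => ?_⟩
  rw [hg.sub_eq hs.1 ht.1, ← Real.norm_eq_abs]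
  refine intervalIntegral.norm_integral_le_of_norm_le_const (fun r hr => ?_)
  have hr' := uIoc_subset_uIcc hr
  exact (hC r (uIcc_subset_Icc hs ht hr')).trans (le_max_left _ _)

lemma continuousOn (hg : HasRate g φ) : ContinuousOn g (Ici 0) := by
  intro t ht
  obtain ⟨C, hC0, -, hC⟩ := hg.exists_lipschitz (t + 1)
  have h1 : ContinuousOn g (Icc 0 (t + 1)) := by
    have : LipschitzOnWith C.toNNReal g (Icc 0 (t + 1)) := by
      refine LipschitzOnWith.of_dist_le_mul fun x hx y hy => ?_
      rw [Real.dist_eq, Real.dist_eq, Real.coe_toNNReal _ hC0]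
      exact hC y hy x hx
    exact this.continuousOn
  have h2 := h1 t ⟨ht, by linarith⟩
  refine h2.mono_of_mem_nhdsWithin ?_
  have : Iio (t + 1) ∈ 𝓝 t := Iio_mem_nhds (by linarith)
  filter_upwards [self_mem_nhdsWithin, mem_nhdsWithin_of_mem_nhds this] with x h1 h2
  exact ⟨h1, le_of_lt h2⟩

lemma exists_bound (hg : HasRate g φ) (T : ℝ) : ∃ C, 0 ≤ C ∧ ∀ s ∈ Icc 0 T, |g s| ≤ C := by
  obtain ⟨C, hC⟩ := isCompact_Icc.exists_bound_of_continuousOn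
    (hg.continuousOn.mono (Icc_subset_Ici_self : Icc 0 T ⊆ Ici 0))
  exact ⟨max C 0, le_max_right _ _, fun s hs => (hC s hs).trans (le_max_left _ _)⟩

lemma const (a : ℝ) : HasRate (fun _ => a) (fun _ => 0) :=
  ⟨fun _ _ => by simp, fun _ => ⟨0, by simp⟩, by simp⟩

lemma of_hasDerivAt (h : ∀ t, HasDerivAt g (φ t) t) (hφ : Continuous φ) : HasRate g φ where
  intervalIntegrable t _ := hφ.intervalIntegrable 0 t
  bounded T := isCompact_Icc.exists_bound_of_continuousOn hφ.continuousOn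
  eq t _ := by
    rw [intervalIntegral.integral_eq_sub_of_hasDerivAt (fun s _ => h s)
      (hφ.intervalIntegrable 0 t)]
    ring

lemma add (hf : HasRate f φ) (hg : HasRate g ψ) :
    HasRate (fun t => f t + g t) (fun t => φ t + ψ t) where
  intervalIntegrable t ht := (hf.intervalIntegrable t ht).add (hg.intervalIntegrable t ht)
  bounded T := by
    obtain ⟨C, hC⟩ := hf.bounded T
    obtain ⟨D, hD⟩ := hg.bounded T
    exact ⟨C + D, fun s hs => (abs_add_le _ _).trans (add_le_add (hC s hs) (hD s hs))⟩
  eq t ht := by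
    rw [intervalIntegral.integral_add (hf.intervalIntegrable t ht) (hg.intervalIntegrable t ht),
      hf.eq t ht, hg.eq t ht]
    ring

lemma const_mul (a : ℝ) (hg : HasRate g φ) : HasRate (fun t => a * g t) (fun t => a * φ t) where
  intervalIntegrable t ht := (hg.intervalIntegrable t ht).const_mul a
  bounded T := by
    obtain ⟨C, hC⟩ := hg.bounded T
    exact ⟨|a| * C, fun s hs => by
      rw [abs_mul]; exact mul_le_mul_of_nonneg_left (hC s hs) (abs_nonneg a)⟩
  eq t ht := by
    rw [intervalIntegral.integral_const_mul, hg.eq t ht]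
    ring

lemma sub (hf : HasRate f φ) (hg : HasRate g ψ) :
    HasRate (fun t => f t - g t) (fun t => φ t - ψ t) := by
  simpa [sub_eq_add_neg] using hf.add (hg.const_mul (-1))

/-- The difference `E` between the product and the integral of the proposed rate has increments of
order `(t - s) ^ 2`, because `f` and `g` are locally Lipschitz. Its right derivative therefore
vanishes and `E` is constant; no a.e. differentiation is needed. -/
lemma mul (hf : HasRate f φ) (hg : HasRate g ψ) :
    HasRate (fun t => f t * g t) (fun t => φ t * g t + f t * ψ t) := by
  have hint : ∀ s t, 0 ≤ s → 0 ≤ t →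
      IntervalIntegrable (fun t => φ t * g t + f t * ψ t) volume s t := by
    intro s t hs ht
    have hsub : uIcc s t ⊆ Ici 0 := fun x hx => (le_min hs ht).trans hx.1
    exact ((hf.intervalIntegrable' hs ht).mul_continuousOn (hg.continuousOn.mono hsub)).add
      ((hg.intervalIntegrable' hs ht).continuousOn_mul (hf.continuousOn.mono hsub))
  refine ⟨fun t ht => hint 0 t le_rfl ht, fun T => ?_, fun T hT => ?_⟩
  · obtain ⟨C, hC⟩ := hf.bounded T
    obtain ⟨D, hD⟩ := hg.bounded T
    obtain ⟨A, hA0, hA⟩ := hf.exists_bound T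
    obtain ⟨B, hB0, hB⟩ := hg.exists_bound T
    refine ⟨C * B + A * D, fun s hs => (abs_add_le _ _).trans ?_⟩
    rw [abs_mul, abs_mul]
    exact add_le_add
      (mul_le_mul (hC s hs) (hB s hs) (abs_nonneg _) ((abs_nonneg _).trans (hC s hs)))
      (mul_le_mul (hA s hs) (hD s hs) (abs_nonneg _) hA0)
  · obtain ⟨C, hC0, hC, hC'⟩ := hf.exists_lipschitz T
    obtain ⟨D, hD0, hD, hD'⟩ := hg.exists_lipschitz T
    set E : ℝ → ℝ := fun t => f t * g t - ∫ s in (0 : ℝ)..t, (φ s * g s + f s * ψ s) with hE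
    have key : ∀ s ∈ Icc 0 T, ∀ t ∈ Icc 0 T, s ≤ t → |E t - E s| ≤ 2 * C * D * (t - s) ^ 2 := by
      intro s hs t ht hst
      have e1 : E t - E s = ∫ r in s..t, (φ r * (g t - g r) + (f s - f r) * ψ r) := by
        have a1 : ∫ r in s..t, (φ r * g t + f s * ψ r) = (f t - f s) * g t + f s * (g t - g s) := by
          rw [intervalIntegral.integral_add ((hf.intervalIntegrable' hs.1 ht.1).mul_const _)
            ((hg.intervalIntegrable' hs.1 ht.1).const_mul _), intervalIntegral.integral_mul_const,
            intervalIntegral.integral_const_mul, hf.sub_eq hs.1 ht.1, hg.sub_eq hs.1 ht.1]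
        have a2 : (∫ r in (0 : ℝ)..t, (φ r * g r + f r * ψ r)) -
            ∫ r in (0 : ℝ)..s, (φ r * g r + f r * ψ r) =
            ∫ r in s..t, (φ r * g r + f r * ψ r) :=
          intervalIntegral.integral_interval_sub_left (hint 0 t le_rfl ht.1) (hint 0 s le_rfl hs.1)
        have a3 : ∫ r in s..t, (φ r * (g t - g r) + (f s - f r) * ψ r) =
            (∫ r in s..t, (φ r * g t + f s * ψ r)) - ∫ r in s..t, (φ r * g r + f r * ψ r) := by
          rw [← intervalIntegral.integral_sub
            (((hf.intervalIntegrable' hs.1 ht.1).mul_const _).add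
              ((hg.intervalIntegrable' hs.1 ht.1).const_mul _)) (hint s t hs.1 ht.1)]
          congr 1
          ext r
          ring
        rw [a3, a1, ← a2]
        simp only [hE]
        ring
      have e2 : |∫ r in s..t, (φ r * (g t - g r) + (f s - f r) * ψ r)| ≤
          (2 * C * D * (t - s)) * |t - s| := by
        rw [← Real.norm_eq_abs]
        refine intervalIntegral.norm_integral_le_of_norm_le_const (fun r hr => ?_)
        rw [uIoc_of_le hst] at hr
        have hr' : r ∈ Icc 0 T := ⟨hs.1.trans hr.1.le, hr.2.trans ht.2⟩
        rw [Real.norm_eq_abs]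
        refine (abs_add_le _ _).trans ?_
        rw [abs_mul, abs_mul]
        have b1 : |g t - g r| ≤ D * (t - s) := by
          refine (hD' r hr' t ht).trans (mul_le_mul_of_nonneg_left ?_ hD0)
          rw [abs_of_nonneg (by linarith [hr.2])]
          linarith [hr.1]
        have b2 : |f s - f r| ≤ C * (t - s) := by
          refine (hC' r hr' s hs).trans (mul_le_mul_of_nonneg_left ?_ hC0)
          rw [abs_of_nonpos (by linarith [hr.1])]
          linarith [hr.2]
        have b3 := mul_le_mul (hC r hr') b1 (abs_nonneg _) hC0
        have b4 := mul_le_mul b2 (hD r hr') (abs_nonneg _) (mul_nonneg hC0 (by linarith))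
        linarith
      rw [e1]
      refine e2.trans (le_of_eq ?_)
      rw [abs_of_nonneg (by linarith)]
      ring
    have hconst : ∀ x ∈ Icc 0 T, E x = E 0 := by
      refine constant_of_has_deriv_right_zero ?_ ?_
      · refine ContinuousOn.sub ((hf.continuousOn.mul hg.continuousOn).mono Icc_subset_Ici_self) ?_
        have := intervalIntegral.continuousOn_primitive_interval (μ := volume) (a := 0) (b := T)
          (f := fun s => φ s * g s + f s * ψ s) ?_
        · rwa [uIcc_of_le hT] at this
        · rw [uIcc_of_le hT, integrableOn_Icc_iff_integrableOn_Ioc]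
          exact (intervalIntegrable_iff_integrableOn_Ioc_of_le hT).1 (hint 0 T le_rfl hT)
      · intro x hx
        rw [hasDerivWithinAt_iff_isLittleO]
        have hO : (fun t => E t - E x - (t - x) • (0 : ℝ)) =O[𝓝[≥] x] fun t => (t - x) ^ 2 := by
          refine Asymptotics.IsBigO.of_bound (2 * C * D) ?_
          have : Iio T ∈ 𝓝 x := Iio_mem_nhds hx.2
          filter_upwards [self_mem_nhdsWithin, mem_nhdsWithin_of_mem_nhds this] with t h1 h2
          have := key x ⟨hx.1, hx.2.le⟩ t ⟨hx.1.trans h1, le_of_lt h2⟩ h1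
          simpa using this
        refine hO.trans_isLittleO ?_
        have h2 : (fun t : ℝ => (t - x) ^ 2) =o[𝓝 x] fun t => t - x := by
          have h3 : Tendsto (fun t : ℝ => t - x) (𝓝 x) (𝓝 0) := by
            have : Continuous fun t : ℝ => t - x := by fun_prop
            simpa using this.tendsto x
          have := (Asymptotics.isLittleO_pow_id (𝕜 := ℝ) (n := 2) (by norm_num)).comp_tendsto h3
          simpa [Function.comp_def] using this
        exact h2.mono nhdsWithin_le_nhds
    have := hconst T ⟨hT, le_rfl⟩
    simp only [hE, intervalIntegral.integral_same, sub_zero] at this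
    linarith

/-- Gronwall comparison: a function whose rate is at most `K g` where `g > 0` stays nonpositive. -/
lemma nonpos (hg : HasRate g φ) {T K : ℝ} (hT : 0 ≤ T) (h0 : g 0 ≤ 0)
    (hφ : ∀ s ∈ Ico 0 T, 0 < g s → φ s ≤ K * g s) : g T ≤ 0 := by
  by_contra! hpos
  have hcont : ContinuousOn g (Icc 0 T) := hg.continuousOn.mono Icc_subset_Ici_self
  have hcpt : IsCompact (Icc 0 T ∩ g ⁻¹' Iic 0) :=
    isCompact_Icc.of_isClosed_subset (hcont.preimage_isClosed_of_isClosed isClosed_Icc isClosed_Iic)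
      inter_subset_left
  -- `τ` is the last time in `[0, T]` with `g ≤ 0`. On a window of length `η` after `τ`, short
  -- enough that `L * η ≤ 1 / 2`, the maximum `g m` would satisfy `g m ≤ g τ + g m / 2`, which is
  -- impossible for `g m > 0`.
  obtain ⟨τ, ⟨hτ, hτ0⟩, hmax⟩ := hcpt.exists_isGreatest ⟨0, ⟨le_rfl, hT⟩, h0⟩
  have hτT : τ < T := lt_of_le_of_ne hτ.2 (by rintro rfl; exact absurd hτ0 (not_le.2 hpos))
  have hposs : ∀ s, τ < s → s ≤ T → 0 < g s := by
    intro s h1 h2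
    by_contra! h3
    exact absurd (hmax ⟨⟨hτ.1.trans h1.le, h2⟩, h3⟩) (not_le.2 h1)
  set L := max K 1
  have hL : 0 < L := lt_of_lt_of_le one_pos (le_max_right _ _)
  set η := min (T - τ) (1 / (2 * L))
  have hη : 0 < η := lt_min (by linarith) (by positivity)
  have hη1 : η ≤ T - τ := min_le_left _ _
  have hη2 : L * η ≤ 1 / 2 := by
    have : η ≤ 1 / (2 * L) := min_le_right _ _
    calc L * η ≤ L * (1 / (2 * L)) := mul_le_mul_of_nonneg_left this hL.le
      _ = 1 / 2 := by field_simp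
  obtain ⟨m, hm, hmm⟩ := isCompact_Icc.exists_isMaxOn (nonempty_Icc.2 (by linarith : τ ≤ τ + η))
    (hcont.mono (Icc_subset_Icc hτ.1 (by linarith)))
  have hgm : 0 < g m := lt_of_lt_of_le (hposs (τ + η) (by linarith) (by linarith))
    (hmm ⟨by linarith, le_rfl⟩)
  have hle : g m - g τ ≤ L * g m * (m - τ) := by
    rw [hg.sub_eq hτ.1 (hτ.1.trans hm.1)]
    calc ∫ r in τ..m, φ r ≤ ∫ _ in τ..m, L * g m := by
          refine intervalIntegral.integral_mono_on_of_le_Ioo hm.1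
            (hg.intervalIntegrable' hτ.1 (hτ.1.trans hm.1)) (by simp) fun s hs => ?_
          have hs1 : 0 < g s := hposs s hs.1 (by linarith [hs.2, hm.2])
          have hs2 : g s ≤ g m := hmm ⟨hs.1.le, hs.2.le.trans hm.2⟩
          refine (hφ s ⟨hτ.1.trans hs.1.le, by linarith [hs.2, hm.2]⟩ hs1).trans ?_
          exact mul_le_mul (le_max_left _ _) hs2 hs1.le hL.le
      _ = L * g m * (m - τ) := by rw [intervalIntegral.integral_const, smul_eq_mul, mul_comm]
  have h1 : L * g m * (m - τ) ≤ g m * (1 / 2) := by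
    have : m - τ ≤ η := by linarith [hm.2]
    calc L * g m * (m - τ) ≤ L * g m * η := mul_le_mul_of_nonneg_left this (by positivity)
      _ = g m * (L * η) := by ring
      _ ≤ g m * (1 / 2) := mul_le_mul_of_nonneg_left hη2 hgm.le
  have h2 : g τ ≤ 0 := hτ0
  linarith

end HasRate

/-! ### Existence for integral equations. -/

lemma hasDerivAt_exp_mul (K s : ℝ) :
    HasDerivAt (fun s => Real.exp (K * s)) (K * Real.exp (K * s)) s := by
  simpa [mul_comm] using ((hasDerivAt_id s).const_mul K).exp

/-- Existence for Carathéodory integral equations on `[0, ∞)` with bounded and uniformly Lipschitz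
right-hand side: a fixed point in an exponentially weighted space. -/
lemma exists_integral_solution {F : ℝ → ℝ → ℝ} {C L : ℝ} (hL : 0 < L)
    (hint : ∀ y : ℝ → ℝ, Continuous y → ∀ t, 0 ≤ t →
      IntervalIntegrable (fun s => F s (y s)) volume 0 t)
    (hbd : ∀ s, 0 ≤ s → ∀ y, |F s y| ≤ C)
    (hLip : ∀ s, 0 ≤ s → ∀ x y, |F s x - F s y| ≤ L * |x - y|) (a : ℝ) :
    ∃ g : ℝ → ℝ, Continuous g ∧ ∀ t, 0 ≤ t → g t = a + ∫ s in (0 : ℝ)..t, F s (g s) := by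
  have hC : 0 ≤ C := (abs_nonneg _).trans (hbd 0 le_rfl 0)
  -- The unknown is `y t = exp (-K t) * g t`. With this weight the integral operator contracts by
  -- the factor `L / K = 1 / 2`.
  obtain ⟨K, hK⟩ : ∃ K, K = 2 * L := ⟨_, rfl⟩
  have hK0 : 0 < K := by rw [hK]; positivity
  have hexp : ∀ y : BoundedContinuousFunction ℝ ℝ, Continuous fun s => Real.exp (K * s) * y s :=
    fun y => by fun_prop
  have hrate : ∀ y : BoundedContinuousFunction ℝ ℝ,
      HasRate (fun t => ∫ s in (0 : ℝ)..t, F s (Real.exp (K * s) * y s))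
        (fun s => F s (Real.exp (K * s) * y s)) := fun y =>
    ⟨hint _ (hexp y), fun T => ⟨C, fun s hs => hbd s hs.1 _⟩, fun t _ => by simp⟩
  -- Time enters through `max t 0`, which extends the image constantly to negative times and makes
  -- it bounded and continuous on all of `ℝ`.
  have hcont : ∀ y : BoundedContinuousFunction ℝ ℝ, Continuous fun t : ℝ =>
      Real.exp (-K * max t 0) *
        (a + ∫ s in (0 : ℝ)..(max t 0), F s (Real.exp (K * s) * y s)) := by
    intro y
    have h1 : Continuous fun t : ℝ =>
        ∫ s in (0 : ℝ)..(max t 0), F s (Real.exp (K * s) * y s) :=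
      (hrate y).continuousOn.comp_continuous (by fun_prop) (fun t => le_max_right t 0)
    have h2 : Continuous fun t : ℝ => Real.exp (-K * max t 0) := by fun_prop
    exact h2.mul (continuous_const.add h1)
  have hbound : ∀ (y : BoundedContinuousFunction ℝ ℝ) (t : ℝ),
      ‖Real.exp (-K * max t 0) *
        (a + ∫ s in (0 : ℝ)..(max t 0), F s (Real.exp (K * s) * y s))‖ ≤ |a| + C / K := by
    intro y t
    set τ := max t 0
    have hτ : 0 ≤ τ := le_max_right t 0
    have h1 : |∫ s in (0 : ℝ)..τ, F s (Real.exp (K * s) * y s)| ≤ C * τ := by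
      rw [← Real.norm_eq_abs]
      refine (intervalIntegral.norm_integral_le_of_norm_le_const (C := C) fun s hs => ?_).trans ?_
      · rw [uIoc_of_le hτ] at hs
        exact hbd s hs.1.le _
      · rw [sub_zero, abs_of_nonneg hτ]
    have h2 : Real.exp (-K * τ) ≤ 1 := Real.exp_le_one_iff.2 (by nlinarith)
    have h3 : Real.exp (-K * τ) * (K * τ) ≤ 1 := by
      have h4 : K * τ ≤ Real.exp (K * τ) := by linarith [Real.add_one_le_exp (K * τ)]
      calc Real.exp (-K * τ) * (K * τ) ≤ Real.exp (-K * τ) * Real.exp (K * τ) :=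
            mul_le_mul_of_nonneg_left h4 (Real.exp_pos _).le
        _ = 1 := by rw [← Real.exp_add]; simp
    rw [Real.norm_eq_abs, abs_mul, abs_of_pos (Real.exp_pos _)]
    calc Real.exp (-K * τ) * |a + ∫ s in (0 : ℝ)..τ, F s (Real.exp (K * s) * y s)|
        ≤ Real.exp (-K * τ) * (|a| + C * τ) :=
          mul_le_mul_of_nonneg_left ((abs_add_le _ _).trans (by linarith)) (Real.exp_pos _).le
      _ = Real.exp (-K * τ) * |a| + C / K * (Real.exp (-K * τ) * (K * τ)) := by
          field_simp
      _ ≤ 1 * |a| + C / K * 1 := add_le_add (mul_le_mul_of_nonneg_right h2 (abs_nonneg a))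
          (mul_le_mul_of_nonneg_left h3 (by positivity))
      _ = |a| + C / K := by ring
  set Φ : BoundedContinuousFunction ℝ ℝ → BoundedContinuousFunction ℝ ℝ := fun y =>
    BoundedContinuousFunction.ofNormedAddCommGroup _ (hcont y) _ (hbound y)
  have hΦ : ∀ y t, Φ y t = Real.exp (-K * max t 0) *
      (a + ∫ s in (0 : ℝ)..(max t 0), F s (Real.exp (K * s) * y s)) := fun _ _ => rfl
  have hcontr : ContractingWith (1 / 2) Φ := by
    refine ⟨by rw [← NNReal.coe_lt_coe]; norm_num, LipschitzWith.of_dist_le_mul fun y z => ?_⟩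
    have hd0 : 0 ≤ dist y z := dist_nonneg
    rw [BoundedContinuousFunction.dist_le (by positivity)]
    intro t
    set τ := max t 0
    have hτ : 0 ≤ τ := le_max_right t 0
    have e1 : dist (Φ y t) (Φ z t) = Real.exp (-K * τ) *
        |∫ s in (0 : ℝ)..τ, (F s (Real.exp (K * s) * y s) - F s (Real.exp (K * s) * z s))| := by
      rw [intervalIntegral.integral_sub (hint _ (hexp y) τ hτ) (hint _ (hexp z) τ hτ),
        Real.dist_eq, hΦ, hΦ, ← mul_sub, add_sub_add_left_eq_sub, abs_mul, abs_of_pos (Real.exp_pos _)]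
    have e2 : |∫ s in (0 : ℝ)..τ,
        (F s (Real.exp (K * s) * y s) - F s (Real.exp (K * s) * z s))| ≤
        ∫ s in (0 : ℝ)..τ, L * dist y z * Real.exp (K * s) := by
      rw [← Real.norm_eq_abs]
      refine intervalIntegral.norm_integral_le_of_norm_le hτ (ae_of_all _ fun s hs => ?_)
        (Continuous.intervalIntegrable (by fun_prop) _ _)
      rw [Real.norm_eq_abs]
      refine (hLip s hs.1.le _ _).trans ?_
      rw [← mul_sub, abs_mul, abs_of_pos (Real.exp_pos _), ← Real.dist_eq]
      have := BoundedContinuousFunction.dist_coe_le_dist (f := y) (g := z) s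
      calc L * (Real.exp (K * s) * dist (y s) (z s))
          ≤ L * (Real.exp (K * s) * dist y z) := by gcongr
        _ = _ := by ring
    have e3 : ∫ s in (0 : ℝ)..τ, L * dist y z * Real.exp (K * s) =
        dist y z / 2 * (Real.exp (K * τ) - 1) := by
      have h1 : ∀ s : ℝ, HasDerivAt (fun s => dist y z / 2 * Real.exp (K * s))
          (L * dist y z * Real.exp (K * s)) s := by
        intro s
        refine ((hasDerivAt_exp_mul K s).const_mul (dist y z / 2)).congr_deriv ?_
        rw [hK]
        ring
      rw [intervalIntegral.integral_eq_sub_of_hasDerivAt (fun s _ => h1 s)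
        (Continuous.intervalIntegrable (by fun_prop) _ _)]
      simp
      ring
    rw [e1]
    calc _ ≤ Real.exp (-K * τ) * (dist y z / 2 * (Real.exp (K * τ) - 1)) :=
          mul_le_mul_of_nonneg_left (e2.trans e3.le) (Real.exp_pos _).le
      _ = dist y z / 2 * (Real.exp (-K * τ) * Real.exp (K * τ)) -
          dist y z / 2 * Real.exp (-K * τ) := by ring
      _ = dist y z / 2 - dist y z / 2 * Real.exp (-K * τ) := by rw [← Real.exp_add]; simp
      _ ≤ _ := by
          have : 0 ≤ dist y z / 2 * Real.exp (-K * τ) := by positivity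
          push_cast
          linarith
  have hfix : Φ (ContractingWith.fixedPoint Φ hcontr) = ContractingWith.fixedPoint Φ hcontr :=
    hcontr.fixedPoint_isFixedPt
  set y := ContractingWith.fixedPoint Φ hcontr
  refine ⟨fun t => Real.exp (K * t) * y t, hexp y, fun t ht => ?_⟩
  have h1 : y t = Real.exp (-K * t) *
      (a + ∫ s in (0 : ℝ)..t, F s (Real.exp (K * s) * y s)) := by
    conv_lhs => rw [← hfix, hΦ, max_eq_left ht]
  calc Real.exp (K * t) * y t
      = (Real.exp (K * t) * Real.exp (-K * t)) *
        (a + ∫ s in (0 : ℝ)..t, F s (Real.exp (K * s) * y s)) := by rw [mul_assoc, ← h1]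
    _ = _ := by rw [← Real.exp_add]; simp

/-! ### Admissible controls. -/

/-- Bounded nonnegative Borel controls, without an explicit bound. -/
structure IsAdmissible (h : ℝ → ℝ) : Prop where
  measurable : Measurable h
  nonneg : ∀ t, 0 ≤ t → 0 ≤ h t
  bounded : ∃ M, 0 ≤ M ∧ ∀ t, 0 ≤ t → h t ≤ M

namespace IsAdmissible

variable {h k : ℝ → ℝ}

lemma intervalIntegrable (hh : IsAdmissible h) {s t : ℝ} (hs : 0 ≤ s) (ht : 0 ≤ t) :
    IntervalIntegrable h volume s t := by
  obtain ⟨M, -, hM⟩ := hh.bounded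
  rw [intervalIntegrable_iff]
  refine Measure.integrableOn_of_bounded (M := M) (by simp [uIoc])
    hh.measurable.aestronglyMeasurable ?_
  refine (ae_restrict_iff' measurableSet_uIoc).2 (ae_of_all _ fun r hr => ?_)
  have hr0 : 0 ≤ r := (le_min hs ht).trans hr.1.le
  rw [Real.norm_eq_abs, abs_of_nonneg (hh.nonneg r hr0)]
  exact hM r hr0

lemma const {a : ℝ} (ha : 0 ≤ a) : IsAdmissible fun _ => a :=
  ⟨measurable_const, fun _ _ => ha, a, ha, fun _ _ => le_rfl⟩

lemma min_const (hh : IsAdmissible h) {M : ℝ} (hM : 0 ≤ M) : IsAdmissible fun t => min (h t) M :=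
  ⟨hh.measurable.min measurable_const, fun t ht => le_min (hh.nonneg t ht) hM, M, hM,
    fun _ _ => min_le_right _ _⟩

lemma convexComb (hh : IsAdmissible h) (hk : IsAdmissible k) {a b : ℝ} (ha : 0 ≤ a) (hb : 0 ≤ b) :
    IsAdmissible fun t => a * h t + b * k t := by
  obtain ⟨M, hM0, hM⟩ := hh.bounded
  obtain ⟨N, hN0, hN⟩ := hk.bounded
  refine ⟨(hh.measurable.const_mul a).add (hk.measurable.const_mul b), fun t ht => ?_,
    a * M + b * N, by positivity, fun t ht => ?_⟩
  · have := hh.nonneg t ht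
    have := hk.nonneg t ht
    positivity
  · exact add_le_add (mul_le_mul_of_nonneg_left (hM t ht) ha)
      (mul_le_mul_of_nonneg_left (hN t ht) hb)

lemma shift (hh : IsAdmissible h) {τ : ℝ} (hτ : 0 ≤ τ) : IsAdmissible fun t => h (t + τ) := by
  obtain ⟨M, hM0, hM⟩ := hh.bounded
  exact ⟨hh.measurable.comp (measurable_id.add_const τ), fun t ht => hh.nonneg _ (by linarith), M,
    hM0, fun t ht => hM _ (by linarith)⟩

lemma concat (hh : IsAdmissible h) (hk : IsAdmissible k) (τ : ℝ) :
    IsAdmissible fun t => if t < τ then h t else k (t - τ) := by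
  obtain ⟨M, hM0, hM⟩ := hh.bounded
  obtain ⟨N, hN0, hN⟩ := hk.bounded
  refine ⟨Measurable.ite measurableSet_Iio hh.measurable
    (hk.measurable.comp (measurable_id.sub_const τ)), fun t ht => ?_, max M N,
    le_max_of_le_left hM0, fun t ht => ?_⟩
  · split_ifs with h1
    · exact hh.nonneg t ht
    · exact hk.nonneg _ (by linarith)
  · split_ifs with h1
    · exact (hM t ht).trans (le_max_left _ _)
    · exact (hN _ (by linarith)).trans (le_max_right _ _)

end IsAdmissible

/-! ### Model constants and estimates on the drift. -/

namespace Params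

variable (P : Params)

lemma a₁_pos : 0 < P.a₁ := by
  have h1 := P.δ_pos
  have h2 := P.ρ_pos
  have h3 := P.κ_pos
  have : P.δ * P.ρ < √(P.δ ^ 2 * P.ρ ^ 2 + 4 * P.κ * P.ρ) := by
    apply Real.lt_sqrt_of_sq_lt
    have : 0 < 4 * P.κ * P.ρ := by positivity
    nlinarith
  unfold a₁
  linarith

lemma a₃_pos : 0 < P.a₃ := by
  have h1 := P.δ_pos
  have h2 := P.ρ_pos
  have h3 := P.lam_nonneg
  have h4 := P.a₁_pos
  unfold a₃
  positivity

/-- The factor `2 λ + δ` cancels against the denominator of `a₂`, leaving a form that is visibly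
positive. -/
lemma aBar_eq : P.aBar = P.a₃ ^ 2 / (2 * P.ρ) := by
  have h1 := P.δ_pos
  have h2 := P.ρ_pos
  have h3 := P.lam_nonneg
  have h4 : 2 * P.lam + P.δ ≠ 0 := by positivity
  unfold aBar a₂
  field_simp
  ring

lemma aBar_pos : 0 < P.aBar := by
  rw [P.aBar_eq]
  have := P.a₃_pos
  have := P.ρ_pos
  positivity

lemma Lv_pos : 0 < P.Lv := div_pos P.aBar_pos P.δ_pos

lemma precision_pos : 0 < (1 / P.σ₁) ^ 2 := by
  have := P.σ₁_pos
  positivity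

lemma gammaInfty_nonneg : 0 ≤ P.gammaInfty := by
  have h1 := P.lam_nonneg
  have : P.lam * P.σ₁ ^ 2 ≤ √(P.lam ^ 2 * P.σ₁ ^ 4 + P.σ₁ ^ 2 * P.σ₂ ^ 2) := by
    apply Real.le_sqrt_of_sq_le
    have : 0 ≤ P.σ₁ ^ 2 * P.σ₂ ^ 2 := by positivity
    nlinarith
  unfold gammaInfty
  linarith

/-- `gammaInfty` is the larger root of the downward parabola `drift · 0`. -/
lemma drift_zero_nonpos {γ : ℝ} (hγ : P.gammaInfty ≤ γ) : P.drift γ 0 ≤ 0 := by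
  have hσ := P.σ₁_pos
  have h0 := P.gammaInfty_nonneg.trans hγ
  have h1 : √(P.lam ^ 2 * P.σ₁ ^ 4 + P.σ₁ ^ 2 * P.σ₂ ^ 2) ≤ γ + P.lam * P.σ₁ ^ 2 := by
    unfold gammaInfty at hγ
    linarith
  have h2 := (Real.sqrt_le_left (by have := P.lam_nonneg; positivity)).1 h1
  have h3 : P.drift γ 0 =
      (1 / P.σ₁) ^ 2 * (-γ ^ 2 - 2 * P.lam * P.σ₁ ^ 2 * γ + P.σ₁ ^ 2 * P.σ₂ ^ 2) := by
    unfold drift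
    field_simp
    ring
  rw [h3]
  exact mul_nonpos_of_nonneg_of_nonpos P.precision_pos.le (by nlinarith)

lemma drift_anti (γ : ℝ) {h k : ℝ} (hhk : h ≤ k) : P.drift γ k ≤ P.drift γ h := by
  unfold drift
  nlinarith [mul_nonneg (sub_nonneg.2 hhk) (sq_nonneg γ)]

lemma drift_nonpos {γ h : ℝ} (hγ : P.gammaInfty ≤ γ) (hh : 0 ≤ h) : P.drift γ h ≤ 0 :=
  (P.drift_anti γ hh).trans (P.drift_zero_nonpos hγ)

/-- This one-sided monotonicity lets most comparison arguments below run with Gronwall constant `0`,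
without exponential growth. -/
lemma drift_le_drift {x y h : ℝ} (hx : 0 ≤ x) (hxy : x ≤ y) (hh : 0 ≤ h) :
    P.drift y h ≤ P.drift x h := by
  have h1 := P.precision_pos
  have h2 := P.lam_nonneg
  have hy : 0 ≤ y := hx.trans hxy
  have h3 : 0 ≤ (((1 / P.σ₁) ^ 2 + h) * (x + y) + 2 * P.lam) * (y - x) :=
    mul_nonneg (by positivity) (by linarith)
  unfold drift
  linarith

/-- A Lipschitz constant of the drift on `[0, B]` for controls bounded by `M`. -/
def driftLip (B M : ℝ) : ℝ := ((1 / P.σ₁) ^ 2 + M) * (2 * B) + 2 * P.lam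

lemma driftLip_nonneg {B M : ℝ} (hB : 0 ≤ B) (hM : 0 ≤ M) : 0 ≤ P.driftLip B M := by
  have h2 := P.lam_nonneg
  unfold driftLip
  positivity

lemma abs_drift_sub_le {x y h B M : ℝ} (hx : x ∈ Icc 0 B) (hy : y ∈ Icc 0 B) (hh : h ∈ Icc 0 M) :
    |P.drift x h - P.drift y h| ≤ P.driftLip B M * |x - y| := by
  have h1 := P.precision_pos
  have h2 := P.lam_nonneg
  have hx0 := hx.1
  have hy0 := hy.1
  have hh0 := hh.1
  have e : P.drift x h - P.drift y h =
      -((((1 / P.σ₁) ^ 2 + h) * (x + y) + 2 * P.lam) * (x - y)) := by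
    unfold drift
    ring
  have h3 : 0 ≤ ((1 / P.σ₁) ^ 2 + h) * (x + y) + 2 * P.lam := by positivity
  rw [e, abs_neg, abs_mul, abs_of_nonneg h3]
  refine mul_le_mul_of_nonneg_right ?_ (abs_nonneg _)
  unfold driftLip
  have : ((1 / P.σ₁) ^ 2 + h) * (x + y) ≤ ((1 / P.σ₁) ^ 2 + M) * (2 * B) :=
    mul_le_mul (by linarith [hh.2]) (by linarith [hx.2, hy.2]) (by positivity)
      (by linarith [hh.2])
  linarith

/-- A bound of the drift on `[0, B]` for controls bounded by `M`. -/
def driftBound (B M : ℝ) : ℝ := ((1 / P.σ₁) ^ 2 + M) * B ^ 2 + 2 * P.lam * B + P.σ₂ ^ 2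

lemma driftBound_nonneg {B M : ℝ} (hB : 0 ≤ B) (hM : 0 ≤ M) : 0 ≤ P.driftBound B M := by
  have h2 := P.lam_nonneg
  unfold driftBound
  positivity

lemma abs_drift_le {x h B M : ℝ} (hx : x ∈ Icc 0 B) (hh : h ∈ Icc 0 M) :
    |P.drift x h| ≤ P.driftBound B M := by
  have h1 := P.precision_pos
  have h2 := P.lam_nonneg
  have hx0 := hx.1
  have hh0 := hh.1
  have h3 : ((1 / P.σ₁) ^ 2 + h) * x ^ 2 ≤ ((1 / P.σ₁) ^ 2 + M) * B ^ 2 :=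
    mul_le_mul (by linarith [hh.2]) (pow_le_pow_left₀ hx0 hx.2 2) (by positivity)
      (by linarith [hh.2])
  have h4 : 2 * P.lam * x ≤ 2 * P.lam * B := mul_le_mul_of_nonneg_left hx.2 (by positivity)
  have h5 : 0 ≤ ((1 / P.σ₁) ^ 2 + h) * x ^ 2 := by positivity
  have h6 : 0 ≤ 2 * P.lam * x := by positivity
  have h7 := sq_nonneg P.σ₂
  unfold drift driftBound
  rw [abs_le]
  constructor <;> linarith

lemma intervalIntegrable_drift {h g : ℝ → ℝ} (hh : IsAdmissible h) (hg : ContinuousOn g (Ici 0))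
    {s t : ℝ} (hs : 0 ≤ s) (ht : 0 ≤ t) :
    IntervalIntegrable (fun r => P.drift (g r) (h r)) volume s t := by
  have hsub : uIcc s t ⊆ Ici 0 := fun x hx => (le_min hs ht).trans hx.1
  have hg' := hg.mono hsub
  have h1 : IntervalIntegrable (fun r => h r * (-(g r) ^ 2)) volume s t :=
    (hh.intervalIntegrable hs ht).mul_continuousOn (hg'.pow 2).neg
  have h2 : IntervalIntegrable
      (fun r => -(1 / P.σ₁) ^ 2 * (g r) ^ 2 - 2 * P.lam * g r + P.σ₂ ^ 2) volume s t :=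
    ContinuousOn.intervalIntegrable (by fun_prop)
  refine (h1.add h2).congr (fun r _ => ?_)
  simp only [drift]
  ring

variable {P}

/-! ### Trajectories: a priori bounds, comparison, existence. -/

lemma IsTrajectory.zero {h g : ℝ → ℝ} {γ : ℝ} (hg : P.IsTrajectory h γ g) : g 0 = γ := by
  simpa using hg.2 0 le_rfl

lemma IsTrajectory.hasRate {h g : ℝ → ℝ} {γ : ℝ} (hh : IsAdmissible h)
    (hg : P.IsTrajectory h γ g) : HasRate g fun s => P.drift (g s) (h s) := by
  refine ⟨fun t ht => P.intervalIntegrable_drift hh hg.1 le_rfl ht, fun T => ?_, fun t ht => ?_⟩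
  · obtain ⟨M, hM0, hM⟩ := hh.bounded
    have hc : ContinuousOn (fun s => |P.drift (g s) 0| + M * g s ^ 2) (Icc 0 T) := by
      have := hg.1.mono (Icc_subset_Ici_self : Icc 0 T ⊆ Ici 0)
      unfold drift
      fun_prop
    obtain ⟨C, hC⟩ := isCompact_Icc.exists_bound_of_continuousOn hc
    refine ⟨C, fun s hs => le_trans ?_ ((le_abs_self _).trans (hC s hs))⟩
    have e : P.drift (g s) (h s) = P.drift (g s) 0 - h s * g s ^ 2 := by
      unfold drift
      ring
    rw [e]
    refine (abs_sub _ _).trans (add_le_add le_rfl ?_)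
    have h0 := hh.nonneg s hs.1
    rw [abs_of_nonneg (by positivity)]
    exact mul_le_mul_of_nonneg_right (hM s hs.1) (sq_nonneg _)
  · rw [hg.2 t ht, hg.zero]

/-- Gronwall for `-g`: where `g < 0`, the terms in `λ` and `σ₂` push upwards, and the quadratic term
is at most a local constant times `-g`. -/
lemma IsTrajectory.nonneg {h g : ℝ → ℝ} {γ : ℝ} (hh : IsAdmissible h)
    (hg : P.IsTrajectory h γ g) (hγ : 0 ≤ γ) {t : ℝ} (ht : 0 ≤ t) : 0 ≤ g t := by
  have hr := hg.hasRate hh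
  obtain ⟨M, hM0, hM⟩ := hh.bounded
  obtain ⟨R, hR0, hR⟩ := hr.exists_bound t
  have := (hr.const_mul (-1)).nonpos (K := ((1 / P.σ₁) ^ 2 + M) * R) ht
    (by rw [hg.zero]; linarith) (fun s hs hpos => ?_)
  · linarith
  have h1 := P.precision_pos
  have h2 := mul_nonneg P.lam_nonneg (by linarith : 0 ≤ -g s)
  have h3 := hh.nonneg s hs.1
  have h4 : -g s ≤ R := (neg_le_abs _).trans (hR s ⟨hs.1, hs.2.le⟩)
  have h5 : ((1 / P.σ₁) ^ 2 + h s) * (-g s) ≤ ((1 / P.σ₁) ^ 2 + M) * R :=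
    mul_le_mul (by linarith [hM s hs.1]) h4 (by linarith) (by positivity)
  have h6 := mul_le_mul_of_nonneg_right h5 (by linarith : 0 ≤ -g s)
  unfold drift
  nlinarith [sq_nonneg P.σ₂]

/-- Any level `B ≥ gammaInfty` is a barrier, since the drift is nonpositive above it whatever the
control. -/
lemma IsTrajectory.le_of_gammaInfty_le {h g : ℝ → ℝ} {γ B : ℝ} (hh : IsAdmissible h)
    (hg : P.IsTrajectory h γ g) (hγ : γ ≤ B) (hB : P.gammaInfty ≤ B) {t : ℝ} (ht : 0 ≤ t) :
    g t ≤ B := by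
  have := ((hg.hasRate hh).sub (HasRate.const B)).nonpos (K := 0) ht
    (by rw [hg.zero]; linarith) (fun s hs hpos => ?_)
  · linarith
  have := P.drift_nonpos (by linarith : P.gammaInfty ≤ g s) (hh.nonneg s hs.1)
  linarith

variable (P) in
/-- Comparison of a sub- and a supersolution of `g' = drift g h`. -/
lemma le_of_rates {f g φ ψ h : ℝ → ℝ} (hf : HasRate f φ) (hg : HasRate g ψ) {T : ℝ} (hT : 0 ≤ T)
    (hh : ∀ s ∈ Ico 0 T, 0 ≤ h s) (hg0 : ∀ s ∈ Ico 0 T, 0 ≤ g s)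
    (hφ : ∀ s ∈ Ico 0 T, φ s ≤ P.drift (f s) (h s))
    (hψ : ∀ s ∈ Ico 0 T, P.drift (g s) (h s) ≤ ψ s) (h0 : f 0 ≤ g 0) : f T ≤ g T := by
  have := (hf.sub hg).nonpos (K := 0) hT (by linarith) (fun s hs hpos => ?_)
  · linarith
  have h1 := P.drift_le_drift (hg0 s hs) (by linarith : g s ≤ f s) (hh s hs)
  linarith [hφ s hs, hψ s hs]

/-- Trajectories of ordered controls with ordered initial values. -/
lemma IsTrajectory.le {h k f g : ℝ → ℝ} {γ γ' : ℝ} (hh : IsAdmissible h) (hk : IsAdmissible k)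
    (hf : P.IsTrajectory h γ f) (hg : P.IsTrajectory k γ' g) (hγ' : 0 ≤ γ') (hγ : γ ≤ γ') {T : ℝ}
    (hT : 0 ≤ T) (hkh : ∀ s ∈ Ico 0 T, k s ≤ h s) : f T ≤ g T :=
  P.le_of_rates (hf.hasRate hh) (hg.hasRate hk) hT (fun s hs => hh.nonneg s hs.1)
    (fun s hs => hg.nonneg hk hγ' hs.1) (fun _ _ => le_rfl)
    (fun s hs => P.drift_anti _ (hkh s hs)) (by rwa [hf.zero, hg.zero])

/-- Trajectories from a positive initial value stay positive, locally uniformly. -/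
lemma IsTrajectory.exists_pos_le {h g : ℝ → ℝ} {γ : ℝ} (hh : IsAdmissible h)
    (hg : P.IsTrajectory h γ g) (hγ : 0 < γ) (T : ℝ) :
    ∃ ε > 0, ∀ t ∈ Icc 0 T, ε ≤ g t := by
  obtain ⟨M, hM0, hM⟩ := hh.bounded
  set B := max γ P.gammaInfty
  have hB : 0 ≤ B := hγ.le.trans (le_max_left _ _)
  set K := P.driftLip B M
  have hK : 0 ≤ K := P.driftLip_nonneg hB hM0
  -- The exponential is a subsolution: the drift at `0` is `σ₂² ≥ 0`, so at `x ∈ [0, B]` it is at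
  -- least `-K * x`, with `K` the Lipschitz constant.
  have hexp : HasRate (fun t => γ * Real.exp (-K * t)) (fun t => γ * (-K * Real.exp (-K * t))) :=
    (HasRate.of_hasDerivAt (fun t => hasDerivAt_exp_mul (-K) t) (by fun_prop)).const_mul γ
  refine ⟨γ * Real.exp (-K * T), by positivity, fun t ht => ?_⟩
  have h1 : γ * Real.exp (-K * t) ≤ g t := by
    have := (hexp.sub (hg.hasRate hh)).nonpos (K := 0) ht.1 (by simp [hg.zero])
      (fun s hs hpos => ?_)
    · linarith
    have hgs : g s ∈ Icc 0 B := ⟨hg.nonneg hh hγ.le hs.1,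
      hg.le_of_gammaInfty_le hh (le_max_left _ _) (le_max_right _ _) hs.1⟩
    have h2 := P.abs_drift_sub_le (left_mem_Icc.2 hB) hgs ⟨hh.nonneg s hs.1, hM s hs.1⟩
    have h3 : P.drift 0 (h s) = P.σ₂ ^ 2 := by simp [drift]
    rw [zero_sub, abs_neg, abs_of_nonneg hgs.1, h3] at h2
    have h4 := (abs_le.1 h2).2
    have h5 := sq_nonneg P.σ₂
    nlinarith [mul_nonneg hK (sub_pos.2 (sub_pos.1 hpos)).le]
  refine le_trans (mul_le_mul_of_nonneg_left (Real.exp_le_exp.2 ?_) hγ.le) h1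
  nlinarith [ht.2]

variable (P) in
-- Clamping the state to `[0, B]` makes the drift bounded and globally Lipschitz. Comparison at both
-- ends shows that the solution of the clamped equation never leaves `[0, B]`, so the clamp is
-- inactive.
lemma exists_trajectory {h : ℝ → ℝ} (hh : IsAdmissible h) {γ : ℝ} (hγ : 0 ≤ γ) :
    ∃ g, P.IsTrajectory h γ g := by
  obtain ⟨M, hM0, hM⟩ := hh.bounded
  set B := max γ P.gammaInfty
  have hB : 0 ≤ B := hγ.trans (le_max_left _ _)
  have hmem : ∀ y : ℝ, max (min y B) 0 ∈ Icc 0 B := fun y =>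
    ⟨le_max_right _ _, max_le (min_le_right _ _) hB⟩
  have hhmem : ∀ s, 0 ≤ s → h s ∈ Icc 0 M := fun s hs => ⟨hh.nonneg s hs, hM s hs⟩
  have hL := P.driftLip_nonneg hB hM0
  obtain ⟨g, hgc, hg⟩ := exists_integral_solution
    (F := fun s y => P.drift (max (min y B) 0) (h s)) (C := P.driftBound B M)
    -- The added `1` makes the Lipschitz constant strictly positive, as the fixed-point argument
    -- requires.
    (L := P.driftLip B M + 1) (by linarith)
    (fun y hy t ht => P.intervalIntegrable_drift (g := fun s => max (min (y s) B) 0) hh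
      (by fun_prop) le_rfl ht)
    (fun s hs y => P.abs_drift_le (hmem y) (hhmem s hs))
    (fun s hs x y => (P.abs_drift_sub_le (hmem x) (hmem y) (hhmem s hs)).trans (by
      have h1 : |max (min x B) 0 - max (min y B) 0| ≤ |x - y| := by
        refine (abs_max_sub_max_le_abs _ _ _).trans ((abs_min_sub_min_le_max _ _ _ _).trans ?_)
        simp
      exact mul_le_mul (by linarith) h1 (abs_nonneg _) (by linarith))) γ
  have hr : HasRate g fun s => P.drift (max (min (g s) B) 0) (h s) := by
    refine ⟨fun t ht => P.intervalIntegrable_drift (g := fun s => max (min (g s) B) 0) hh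
      (by fun_prop) le_rfl ht, fun T => ⟨_, fun s hs => P.abs_drift_le (hmem _) (hhmem s hs.1)⟩,
      fun t ht => ?_⟩
    rw [hg t ht, hg 0 le_rfl]
    simp
  have hg0 : g 0 = γ := by simpa using hg 0 le_rfl
  have hlo : ∀ t, 0 ≤ t → 0 ≤ g t := fun t ht => by
    have := (hr.const_mul (-1)).nonpos (K := 0) ht (by rw [hg0]; linarith) (fun s hs hpos => ?_)
    · linarith
    rw [max_eq_right ((min_le_left _ _).trans (by linarith : g s ≤ 0))]
    have : P.drift 0 (h s) = P.σ₂ ^ 2 := by simp [drift]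
    rw [this]
    nlinarith [sq_nonneg P.σ₂]
  have hhi : ∀ t, 0 ≤ t → g t ≤ B := fun t ht => by
    have := (hr.sub (HasRate.const B)).nonpos (K := 0) ht
      (by rw [hg0]; linarith [le_max_left γ P.gammaInfty]) (fun s hs hpos => ?_)
    · linarith
    rw [min_eq_right (by linarith), max_eq_left hB]
    have := P.drift_nonpos (le_max_right γ P.gammaInfty) (hh.nonneg s hs.1)
    linarith
  refine ⟨g, hgc.continuousOn, fun t ht => ?_⟩
  rw [hg t ht]
  congr 1
  refine intervalIntegral.integral_congr fun s hs => ?_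
  rw [uIcc_of_le ht] at hs
  rw [min_eq_left (hhi s hs.1), max_eq_left (hlo s hs.1)]

end Params

/-! ### The cost of information, `(c')⁻¹` and `ĥ`. -/

namespace IsInformationCost

variable {c : ℝ → ℝ}

lemma continuousOn (hc : IsInformationCost c) : ContinuousOn c (Ici 0) :=
  hc.contDiffOn_one.continuousOn

lemma differentiableOn (hc : IsInformationCost c) : DifferentiableOn ℝ c (Ici 0) :=
  hc.contDiffOn_one.differentiableOn one_ne_zero

lemma continuousOn_marginalCost (hc : IsInformationCost c) :
    ContinuousOn (marginalCost c) (Ici 0) :=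
  hc.contDiffOn_one.continuousOn_derivWithin (uniqueDiffOn_Ici 0) le_rfl

lemma marginalCost_mul_le (hc : IsInformationCost c) {x y : ℝ} (hx : 0 ≤ x) (hxy : x ≤ y) :
    marginalCost c x * (y - x) ≤ c y - c x := by
  rcases hxy.eq_or_lt with rfl | hlt
  · simp
  · have := hc.strictConvexOn.convexOn.derivWithin_le_slope hx (hx.trans hxy : (0 : ℝ) ≤ y) hlt
      (hc.differentiableOn x hx)
    rwa [slope_def_field, le_div_iff₀ (sub_pos.2 hlt)] at this

lemma marginalCost_mul_lt (hc : IsInformationCost c) {x y : ℝ} (hx : 0 ≤ x) (hxy : x < y) :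
    marginalCost c x * (y - x) < c y - c x := by
  have := hc.strictConvexOn.derivWithin_lt_slope hx (hx.trans hxy.le : (0 : ℝ) ≤ y) hxy
    (hc.differentiableOn x hx)
  rwa [slope_def_field, lt_div_iff₀ (sub_pos.2 hxy)] at this

lemma exists_le_marginalCost (hc : IsInformationCost c) (x : ℝ) :
    ∃ h, 0 ≤ h ∧ x ≤ marginalCost c h :=
  ((eventually_ge_atTop 0).and (hc.tendsto_marginalCost.eventually_ge_atTop x)).exists

/-- The infimum is attained because `c'` is continuous and unbounded. Only an inequality can hold in
general: below the range of `c'` the infimum is `0`, where `c'` exceeds `x`. -/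
lemma marginalCostInv_mem (hc : IsInformationCost c) (x : ℝ) :
    0 ≤ marginalCostInv c x ∧ x ≤ marginalCost c (marginalCostInv c x) := by
  have hclosed : IsClosed (Ici 0 ∩ marginalCost c ⁻¹' Ici x) :=
    hc.continuousOn_marginalCost.preimage_isClosed_of_isClosed isClosed_Ici isClosed_Ici
  exact hclosed.csInf_mem (hc.exists_le_marginalCost x) ⟨0, fun h hh => hh.1⟩

/-- Strict convexity makes the maximizer unique, and maximizers are bounded by any `k` whose
marginal cost is at least `x`. -/
lemma le_of_isMaxOn (hc : IsInformationCost c) {x h k : ℝ}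
    (hmax : IsMaxOn (fun y => y * x - c y) (Ici 0) h) (hk : 0 ≤ k) (hxk : x ≤ marginalCost c k) :
    h ≤ k := by
  by_contra! hlt
  have h1 := hc.marginalCost_mul_lt hk hlt
  have h2 : k * x - c k ≤ h * x - c h := hmax hk
  nlinarith [mul_le_mul_of_nonneg_right hxk (sub_nonneg.2 hlt.le)]

/-- Past a point `k` with `c' k ≥ x`, the tangent line at `k` shows that the objective is no larger
than at `k`; so maximizing over the compact interval `[0, k]` suffices. -/
lemma exists_isMaxOn (hc : IsInformationCost c) (x : ℝ) :
    ∃ h, 0 ≤ h ∧ IsMaxOn (fun y => y * x - c y) (Ici 0) h := by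
  obtain ⟨k, hk, hxk⟩ := hc.exists_le_marginalCost x
  have hcont : ContinuousOn (fun y => y * x - c y) (Icc 0 k) :=
    (continuousOn_id.mul continuousOn_const).sub (hc.continuousOn.mono Icc_subset_Ici_self)
  obtain ⟨h, hh, hmax⟩ := isCompact_Icc.exists_isMaxOn (nonempty_Icc.2 hk) hcont
  refine ⟨h, hh.1, fun y hy => ?_⟩
  rcases le_total y k with hyk | hyk
  · exact hmax ⟨hy, hyk⟩
  · have h1 := hc.marginalCost_mul_le hk hyk
    have h2 : k * x - c k ≤ h * x - c h := hmax ⟨hk, le_rfl⟩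
    have h3 := mul_le_mul_of_nonneg_right hxk (sub_nonneg.2 hyk)
    show y * x - c y ≤ h * x - c h
    nlinarith

lemma bddAbove_maximizers (hc : IsInformationCost c) (x : ℝ) :
    BddAbove {h : ℝ | 0 ≤ h ∧ IsMaxOn (fun y => y * x - c y) (Ici 0) h} := by
  obtain ⟨k, hk, hxk⟩ := hc.exists_le_marginalCost x
  exact ⟨k, fun h hh => hc.le_of_isMaxOn hh.2 hk hxk⟩

lemma hHat_le_marginalCostInv (hc : IsInformationCost c) (x : ℝ) :
    hHat c x ≤ marginalCostInv c x :=
  csSup_le (hc.exists_isMaxOn x) fun _ hh =>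
    hc.le_of_isMaxOn hh.2 (hc.marginalCostInv_mem x).1 (hc.marginalCostInv_mem x).2

/-- Adding the optimality inequalities of a maximizer `h` for `x` and a maximizer `k` for `y` gives
`(k - h) * (y - x) ≥ 0`. -/
lemma hHat_mono (hc : IsInformationCost c) {x y : ℝ} (hxy : x ≤ y) : hHat c x ≤ hHat c y := by
  rcases hxy.eq_or_lt with rfl | hlt
  · exact le_rfl
  obtain ⟨k, hk0, hk⟩ := hc.exists_isMaxOn y
  refine (csSup_le (hc.exists_isMaxOn x) fun h hh => ?_).trans
    (le_csSup (hc.bddAbove_maximizers y) ⟨hk0, hk⟩)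
  have h1 : k * x - c k ≤ h * x - c h := hh.2 hk0
  have h2 : h * y - c h ≤ k * y - c k := hk hh.1
  nlinarith

end IsInformationCost

lemma hHat_nonneg (c : ℝ → ℝ) (x : ℝ) : 0 ≤ hHat c x := Real.sSup_nonneg fun _ hh => hh.1

/-! ### The cost functional and the removal of the bound on controls. -/

lemma integrableOn_exp_mul {δ C : ℝ} (hδ : 0 < δ) {l : ℝ → ℝ}
    (hm : AEStronglyMeasurable l (volume.restrict (Ioi 0))) (hb : ∀ t, 0 < t → |l t| ≤ C) :
    IntegrableOn (fun t => Real.exp (-δ * t) * l t) (Ioi 0) :=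
  Integrable.mul_bdd (c := C) (integrableOn_exp_mul_Ioi (by linarith : -δ < 0) 0) hm
    ((ae_restrict_iff' measurableSet_Ioi).2 (ae_of_all _ fun t ht => hb t ht))

namespace Params

variable {P : Params} {c h g : ℝ → ℝ} {γ : ℝ}

lemma exists_runningCost_bound (hc : IsInformationCost c) (hh : IsAdmissible h)
    (hg : P.IsTrajectory h γ g) (hγ : 0 ≤ γ) :
    AEStronglyMeasurable (fun t => P.aBar * g t + c (h t)) (volume.restrict (Ioi 0)) ∧
      ∃ C, ∀ t, 0 < t → |P.aBar * g t + c (h t)| ≤ C := by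
  obtain ⟨M, hM0, hM⟩ := hh.bounded
  constructor
  · have h1 : AEStronglyMeasurable (fun t => P.aBar * g t) (volume.restrict (Ioi 0)) :=
      (continuousOn_const.mul (hg.1.mono Ioi_subset_Ici_self)).aestronglyMeasurable
        measurableSet_Ioi
    -- Nothing is known about `c` on the negative axis, so measurability goes through the continuous
    -- function `c (max · 0)`.
    have h2 : Measurable fun t => c (max (h t) 0) :=
      (hc.continuousOn.comp_continuous (f := fun x : ℝ => max x 0) (by fun_prop)
        (fun x => mem_Ici.2 (le_max_right _ _))).measurable.comp hh.measurable
    refine h1.add (h2.aestronglyMeasurable.congr ?_)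
    refine (ae_restrict_iff' measurableSet_Ioi).2 (ae_of_all _ fun t ht => ?_)
    simp only
    rw [max_eq_left (hh.nonneg t (le_of_lt ht))]
  · refine ⟨P.aBar * max γ P.gammaInfty + c M, fun t ht => ?_⟩
    have h0 := hh.nonneg t ht.le
    have h1 := hg.nonneg hh hγ ht.le
    have h2 := hg.le_of_gammaInfty_le hh (le_max_left _ _) (le_max_right _ _) ht.le
    have h3 := P.aBar_pos
    have h4 := hc.nonneg _ h0
    have h5 := hc.strictMonoOn.monotoneOn h0 hM0 (hM t ht.le)
    rw [abs_of_nonneg (by positivity)]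
    exact add_le_add (mul_le_mul_of_nonneg_left h2 h3.le) h5

lemma integrableOn_cost (hc : IsInformationCost c) (hh : IsAdmissible h)
    (hg : P.IsTrajectory h γ g) (hγ : 0 ≤ γ) :
    IntegrableOn (fun t => Real.exp (-P.δ * t) * (P.aBar * g t + c (h t))) (Ioi 0) := by
  obtain ⟨hm, C, hC⟩ := exists_runningCost_bound hc hh hg hγ
  exact integrableOn_exp_mul P.δ_pos hm hC

lemma runningCost_nonneg (hc : IsInformationCost c) (hh : IsAdmissible h)
    (hg : P.IsTrajectory h γ g) (hγ : 0 ≤ γ) {t : ℝ} (ht : 0 ≤ t) :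
    0 ≤ P.aBar * g t + c (h t) :=
  add_nonneg (mul_nonneg P.aBar_pos.le (hg.nonneg hh hγ ht)) (hc.nonneg _ (hh.nonneg t ht))

lemma cost_nonneg (hc : IsInformationCost c) (hh : IsAdmissible h)
    (hg : P.IsTrajectory h γ g) (hγ : 0 ≤ γ) : 0 ≤ P.cost c h g :=
  setIntegral_nonneg measurableSet_Ioi fun _ ht =>
    mul_nonneg (Real.exp_pos _).le (runningCost_nonneg hc hh hg hγ (le_of_lt ht))

/-- Cutting a control off at `hMax c γmax` does not increase the cost. -/
lemma cost_min_le (hc : IsInformationCost c) {γmax : ℝ} (hmax : P.gammaInfty ≤ γmax)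
    (hγ : γ ∈ Icc 0 γmax) (hh : IsAdmissible h) (hg : P.IsTrajectory h γ g) {f : ℝ → ℝ}
    (hf : P.IsTrajectory (fun t => min (h t) (P.hMax c γmax)) γ f) :
    P.cost c (fun t => min (h t) (P.hMax c γmax)) f ≤ P.cost c h g := by
  obtain ⟨hM0, hM⟩ := hc.marginalCostInv_mem (γmax ^ 2 * P.Lv)
  change 0 ≤ P.hMax c γmax at hM0
  change _ ≤ marginalCost c (P.hMax c γmax) at hM
  set M := P.hMax c γmax
  have hk := hh.min_const hM0
  have hfi := integrableOn_cost hc hk hf hγ.1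
  have hgi := integrableOn_cost hc hh hg hγ.1
  have hL := P.Lv_pos
  have hδ := P.δ_pos
  have haL : P.aBar = P.δ * P.Lv := by
    unfold Lv
    field_simp
  have hexp : HasRate (fun t => Real.exp (-P.δ * t)) (fun t => -P.δ * Real.exp (-P.δ * t)) :=
    HasRate.of_hasDerivAt (fun t => hasDerivAt_exp_mul _ t) (by fun_prop)
  -- Integration by parts for `exp (-δ t) * (f - g)`, whose boundary term at `T` has a favourable
  -- sign because `g ≤ f`.
  have hd := hexp.mul ((hf.hasRate hk).sub (hg.hasRate hh))
  have hle : ∀ t, 0 ≤ t → g t ≤ f t := fun t ht =>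
    hg.le hh hk hf hγ.1 le_rfl ht (fun _ _ => min_le_left _ _)
  rw [← sub_nonpos]
  have hsub : P.cost c (fun t => min (h t) M) f - P.cost c h g =
      ∫ t in Ioi (0 : ℝ), (Real.exp (-P.δ * t) * (P.aBar * f t + c (min (h t) M)) -
        Real.exp (-P.δ * t) * (P.aBar * g t + c (h t))) := (integral_sub hfi hgi).symm
  rw [hsub]
  refine le_of_tendsto (intervalIntegral_tendsto_integral_Ioi 0 (hfi.sub hgi) tendsto_id) ?_
  filter_upwards [eventually_ge_atTop 0] with T hT
  have hT0 : (0 : ℝ) ≤ T := hT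
  calc _ ≤ ∫ t in (0 : ℝ)..T, -P.Lv * (-P.δ * Real.exp (-P.δ * t) * (f t - g t) +
        Real.exp (-P.δ * t) * (P.drift (f t) (min (h t) M) - P.drift (g t) (h t))) := by
        refine intervalIntegral.integral_mono_on_of_le_Ioo hT0 ?_
          ((hd.intervalIntegrable T hT0).const_mul _) fun t ht => ?_
        · refine (intervalIntegrable_iff_integrableOn_Ioc_of_le hT0).2 ?_
          exact (hfi.sub hgi).mono_set Ioc_subset_Ioi_self
        · have ht0 := ht.1.le
          have h0 := hh.nonneg t ht0
          have hg0 := hg.nonneg hh hγ.1 ht0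
          have hgm := hg.le_of_gammaInfty_le hh hγ.2 hmax ht0
          have hfg := hle t ht0
          have hk0 : 0 ≤ h t - min (h t) M := sub_nonneg.2 (min_le_left _ _)
          -- Passing from `g` to the larger `f` only lowers the drift, so the difference comes from
          -- the removed control alone, weighted by `g ^ 2 ≤ γmax ^ 2`.
          have h1 : P.drift (f t) (min (h t) M) - P.drift (g t) (h t) ≤
              γmax ^ 2 * (h t - min (h t) M) := by
            have h2 := P.drift_le_drift hg0 hfg (hk.nonneg t ht0)
            have h3 : P.drift (g t) (min (h t) M) - P.drift (g t) (h t) =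
                g t ^ 2 * (h t - min (h t) M) := by
              unfold drift
              ring
            have h4 := mul_le_mul_of_nonneg_right (pow_le_pow_left₀ hg0 hgm 2) hk0
            linarith
          have h2 : P.Lv * (γmax ^ 2 * (h t - min (h t) M)) ≤ c (h t) - c (min (h t) M) := by
            rcases le_total (h t) M with h3 | h3
            · simp [min_eq_left h3]
            · rw [min_eq_right h3]
              have h4 := hc.marginalCost_mul_le hM0 h3
              have h5 := mul_le_mul_of_nonneg_right hM (sub_nonneg.2 h3)
              linarith
          have h3 := mul_le_mul_of_nonneg_left h1 hL.le
          have h4 : 0 ≤ Real.exp (-P.δ * t) * (c (h t) - c (min (h t) M) -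
              P.Lv * (P.drift (f t) (min (h t) M) - P.drift (g t) (h t))) :=
            mul_nonneg (Real.exp_pos _).le (by linarith)
          rw [haL]
          linarith
    _ = -P.Lv * (Real.exp (-P.δ * T) * (f T - g T)) := by
        rw [intervalIntegral.integral_const_mul]
        have := hd.eq T hT0
        simp only [hf.zero, hg.zero, sub_self, mul_zero, zero_add] at this
        rw [this]
    _ ≤ 0 := by
        have := mul_nonneg hL.le (mul_nonneg (Real.exp_pos (-P.δ * T)).le
          (sub_nonneg.2 (hle T hT0)))
        linarith

variable (P) in
/-- The value of the reduced problem over all bounded controls. -/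
def freeValue (c : ℝ → ℝ) (γ : ℝ) : ℝ :=
  sInf {J : ℝ | ∃ h g : ℝ → ℝ, IsAdmissible h ∧ P.IsTrajectory h γ g ∧ J = P.cost c h g}

lemma freeValue_le (hc : IsInformationCost c) (hγ : 0 ≤ γ) (hh : IsAdmissible h)
    (hg : P.IsTrajectory h γ g) : P.freeValue c γ ≤ P.cost c h g := by
  refine csInf_le ⟨0, ?_⟩ ⟨h, g, hh, hg, rfl⟩
  rintro _ ⟨h, g, hh, hg, rfl⟩
  exact cost_nonneg hc hh hg hγ

lemma le_freeValue (hγ : 0 ≤ γ) {a : ℝ}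
    (ha : ∀ h g, IsAdmissible h → P.IsTrajectory h γ g → a ≤ P.cost c h g) :
    a ≤ P.freeValue c γ := by
  obtain ⟨g, hg⟩ := P.exists_trajectory (IsAdmissible.const le_rfl) hγ
  refine le_csInf ⟨_, _, g, IsAdmissible.const le_rfl, hg, rfl⟩ ?_
  rintro _ ⟨h, g, hh, hg, rfl⟩
  exact ha h g hh hg

lemma freeValue_nonneg (hc : IsInformationCost c) (hγ : 0 ≤ γ) : 0 ≤ P.freeValue c γ :=
  le_freeValue hγ fun _ _ hh hg => cost_nonneg hc hh hg hγ

lemma exists_cost_lt (hγ : 0 ≤ γ) {a : ℝ} (ha : P.freeValue c γ < a) :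
    ∃ h g, IsAdmissible h ∧ P.IsTrajectory h γ g ∧ P.cost c h g < a := by
  by_contra! hcon
  exact absurd (le_freeValue hγ hcon) (not_le.2 ha)

lemma IsControl.isAdmissible (hc : IsInformationCost c) {γmax : ℝ} (hh : P.IsControl c γmax h) :
    IsAdmissible h :=
  ⟨hh.1, fun t ht => (hh.2 t ht).1, P.hMax c γmax, (hc.marginalCostInv_mem _).1,
    fun t ht => (hh.2 t ht).2⟩

/-- A near-optimal control with values below `hMax c γmax`. -/
lemma exists_control_cost_lt (hc : IsInformationCost c) {γmax : ℝ} (hmax : P.gammaInfty ≤ γmax)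
    (hγ : γ ∈ Icc 0 γmax) {a : ℝ} (ha : P.freeValue c γ < a) :
    ∃ h g, P.IsControl c γmax h ∧ P.IsTrajectory h γ g ∧ P.cost c h g < a := by
  obtain ⟨h, g, hh, hg, hlt⟩ := exists_cost_lt hγ.1 ha
  have hM0 : 0 ≤ P.hMax c γmax := (hc.marginalCostInv_mem _).1
  have hk := hh.min_const hM0
  obtain ⟨f, hf⟩ := P.exists_trajectory hk hγ.1
  exact ⟨_, f, ⟨hk.measurable, fun t ht => ⟨hk.nonneg t ht, min_le_right _ _⟩⟩, hf,
    (cost_min_le hc hmax hγ hh hg hf).trans_lt hlt⟩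

/-- One inequality holds because every control of the reduced problem is admissible, the other by
cutting off near-optimal controls. The right side no longer mentions `γmax`, which is the asserted
independence. -/
lemma reducedValue_eq (hc : IsInformationCost c) {γmax : ℝ} (hmax : P.gammaInfty ≤ γmax)
    (hγ : γ ∈ Icc 0 γmax) : P.reducedValue c γmax γ = P.freeValue c γ := by
  apply le_antisymm
  · refine le_of_forall_gt_imp_ge_of_dense fun a ha => ?_
    obtain ⟨h, g, hh, hg, hlt⟩ := exists_control_cost_lt hc hmax hγ ha
    have hle : P.reducedValue c γmax γ ≤ P.cost c h g := by
      refine csInf_le ⟨0, ?_⟩ ⟨h, g, hh, hg, rfl⟩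
      rintro _ ⟨h, g, hh, hg, rfl⟩
      exact cost_nonneg hc (hh.isAdmissible hc) hg hγ.1
    exact hle.trans hlt.le
  · have hM0 : 0 ≤ P.hMax c γmax := (hc.marginalCostInv_mem _).1
    obtain ⟨g, hg⟩ := P.exists_trajectory (IsAdmissible.const le_rfl) hγ.1
    refine le_csInf ⟨_, _, g, ⟨measurable_const, fun t _ => ⟨le_rfl, hM0⟩⟩, hg, rfl⟩ ?_
    rintro _ ⟨h, g, hh, hg, rfl⟩
    exact freeValue_le hc hγ.1 (hh.isAdmissible hc) hg

lemma value_eq (hc : IsInformationCost c) (hγ : 0 ≤ γ) : P.value c γ = P.freeValue c γ :=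
  reducedValue_eq hc (γmax := max γ P.gammaInfty + 1) (by linarith [le_max_right γ P.gammaInfty])
    ⟨hγ, by linarith [le_max_left γ P.gammaInfty]⟩

end Params

/-! ### Monotonicity, Lipschitz bound and the two curvature properties of the value. -/

namespace Params

variable {P : Params} {c : ℝ → ℝ}

/-- A weighted sum of two costs as a single integral, so that concavity and convexity can be checked
pointwise in time. -/
lemma comb_cost {h₀ h₁ g₀ g₁ : ℝ → ℝ} {γ₀ γ₁ a b : ℝ} (hc : IsInformationCost c)
    (hh₀ : IsAdmissible h₀) (hg₀ : P.IsTrajectory h₀ γ₀ g₀) (hγ₀ : 0 ≤ γ₀)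
    (hh₁ : IsAdmissible h₁) (hg₁ : P.IsTrajectory h₁ γ₁ g₁) (hγ₁ : 0 ≤ γ₁) :
    IntegrableOn (fun t => Real.exp (-P.δ * t) *
        (a * (P.aBar * g₀ t + c (h₀ t)) + b * (P.aBar * g₁ t + c (h₁ t)))) (Ioi 0) ∧
      a * P.cost c h₀ g₀ + b * P.cost c h₁ g₁ = ∫ t in Ioi (0 : ℝ), Real.exp (-P.δ * t) *
        (a * (P.aBar * g₀ t + c (h₀ t)) + b * (P.aBar * g₁ t + c (h₁ t))) := by
  have i₀ := (integrableOn_cost hc hh₀ hg₀ hγ₀).const_mul a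
  have i₁ := (integrableOn_cost hc hh₁ hg₁ hγ₁).const_mul b
  have e : (fun t => Real.exp (-P.δ * t) *
      (a * (P.aBar * g₀ t + c (h₀ t)) + b * (P.aBar * g₁ t + c (h₁ t)))) =
      fun t => a * (Real.exp (-P.δ * t) * (P.aBar * g₀ t + c (h₀ t))) +
        b * (Real.exp (-P.δ * t) * (P.aBar * g₁ t + c (h₁ t))) := by
    ext t
    ring
  rw [e]
  refine ⟨i₀.add i₁, ?_⟩
  rw [integral_add i₀ i₁, integral_const_mul, integral_const_mul]
  rfl

lemma freeValue_mono (hc : IsInformationCost c) {γ γ' : ℝ} (hγ : 0 ≤ γ) (hγγ' : γ ≤ γ') :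
    P.freeValue c γ ≤ P.freeValue c γ' := by
  have hγ' := hγ.trans hγγ'
  refine le_freeValue hγ' fun h g' hh hg' => ?_
  obtain ⟨g, hg⟩ := P.exists_trajectory hh hγ
  refine (freeValue_le hc hγ hh hg).trans ?_
  refine setIntegral_mono_on (integrableOn_cost hc hh hg hγ) (integrableOn_cost hc hh hg' hγ')
    measurableSet_Ioi fun t ht => mul_le_mul_of_nonneg_left ?_ (Real.exp_pos _).le
  have := hg.le hh hh hg' hγ' hγγ' (le_of_lt ht) fun _ _ => le_rfl
  linarith [mul_le_mul_of_nonneg_left this P.aBar_pos.le]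

/-- Under the same control two trajectories stay within their initial distance, and `aBar * ∫ exp
(-δ t) = aBar / δ = Lv`. -/
lemma freeValue_sub_le (hc : IsInformationCost c) {γ γ' : ℝ} (hγ : 0 ≤ γ) (hγγ' : γ ≤ γ') :
    P.freeValue c γ' - P.freeValue c γ ≤ P.Lv * (γ' - γ) := by
  have hγ' := hγ.trans hγγ'
  rw [sub_le_comm]
  refine le_freeValue hγ fun h g hh hg => ?_
  obtain ⟨g', hg'⟩ := P.exists_trajectory hh hγ'
  rw [sub_le_iff_le_add]
  refine (freeValue_le hc hγ' hh hg').trans ?_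
  have hdist : ∀ t, 0 ≤ t → g' t - g t ≤ γ' - γ := fun t ht => by
    have := (((hg'.hasRate hh).sub (hg.hasRate hh)).sub (HasRate.const (γ' - γ))).nonpos (K := 0)
      ht (by rw [hg.zero, hg'.zero]; linarith) (fun s hs hpos => ?_)
    · linarith
    have := P.drift_le_drift (hg.nonneg hh hγ hs.1) (by linarith : g s ≤ g' s) (hh.nonneg s hs.1)
    linarith
  have hδ := P.δ_pos
  have hi := (integrableOn_exp_mul_Ioi (by linarith : -P.δ < 0) 0).mul_const (P.aBar * (γ' - γ))
  have e : P.cost c h g + P.Lv * (γ' - γ) =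
      ∫ t in Ioi (0 : ℝ), (Real.exp (-P.δ * t) * (P.aBar * g t + c (h t)) +
        Real.exp (-P.δ * t) * (P.aBar * (γ' - γ))) := by
    rw [integral_add (integrableOn_cost hc hh hg hγ) hi, integral_mul_const,
      integral_exp_mul_Ioi (by linarith : -P.δ < 0)]
    unfold cost Lv
    simp
    field_simp
  rw [e]
  refine setIntegral_mono_on (integrableOn_cost hc hh hg' hγ')
    ((integrableOn_cost hc hh hg hγ).add hi) measurableSet_Ioi fun t ht => ?_
  rw [← mul_add]
  refine mul_le_mul_of_nonneg_left ?_ (Real.exp_pos _).le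
  linarith [mul_le_mul_of_nonneg_left (hdist t (le_of_lt ht)) P.aBar_pos.le]

/-- The value function is concave, since the drift is concave in the state. -/
lemma concaveOn_freeValue (hc : IsInformationCost c) :
    ConcaveOn ℝ (Ici 0) (P.freeValue c) := by
  refine ⟨convex_Ici 0, fun x hx y hy a b ha hb hab => ?_⟩
  simp only [smul_eq_mul]
  have hx0 : 0 ≤ x := hx
  have hy0 : 0 ≤ y := hy
  have hz0 : 0 ≤ a * x + b * y := by positivity
  refine le_freeValue hz0 fun h g hh hg => ?_
  obtain ⟨gx, hgx⟩ := P.exists_trajectory hh hx0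
  obtain ⟨gy, hgy⟩ := P.exists_trajectory hh hy0
  have hle : ∀ t, 0 ≤ t → a * gx t + b * gy t ≤ g t := fun t ht =>
    P.le_of_rates (h := h) (((hgx.hasRate hh).const_mul a).add ((hgy.hasRate hh).const_mul b))
      (hg.hasRate hh) ht (fun s hs => hh.nonneg s hs.1) (fun s hs => hg.nonneg hh hz0 hs.1)
      (fun s hs => by
        -- The concavity defect of the drift; it makes the mixture of `gx` and `gy` a subsolution
        -- started at the mixed state.
        have h1 : 0 ≤ ((1 / P.σ₁) ^ 2 + h s) * (a * b * (gx s - gy s) ^ 2) :=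
          mul_nonneg (add_nonneg P.precision_pos.le (hh.nonneg s hs.1)) (by positivity)
        obtain rfl : b = 1 - a := by linarith
        unfold drift
        linarith)
      (fun _ _ => le_rfl) (by rw [hgx.zero, hgy.zero, hg.zero])
  obtain ⟨hi, he⟩ := comb_cost (a := a) (b := b) hc hh hgx hx0 hh hgy hy0
  calc a * P.freeValue c x + b * P.freeValue c y
      ≤ a * P.cost c h gx + b * P.cost c h gy :=
        add_le_add (mul_le_mul_of_nonneg_left (freeValue_le hc hx0 hh hgx) ha)
          (mul_le_mul_of_nonneg_left (freeValue_le hc hy0 hh hgy) hb)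
    _ ≤ P.cost c h g := by
        rw [he]
        refine setIntegral_mono_on hi (integrableOn_cost hc hh hg hz0) measurableSet_Ioi
          fun t ht => mul_le_mul_of_nonneg_left ?_ (Real.exp_pos _).le
        have h1 := mul_le_mul_of_nonneg_left (hle t (le_of_lt ht)) P.aBar_pos.le
        obtain rfl : b = 1 - a := by linarith
        linarith

/-- The trajectory of an averaged control lies below the weighted harmonic mean of the
trajectories. -/
lemma mul_le_mul_of_comb {h₀ h₁ g₀ g₁ g : ℝ → ℝ} {γ₀ γ₁ γ a b : ℝ} (ha : 0 ≤ a) (hb : 0 ≤ b)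
    (hab : a + b = 1) (hh₀ : IsAdmissible h₀) (hg₀ : P.IsTrajectory h₀ γ₀ g₀) (hγ₀ : 0 < γ₀)
    (hh₁ : IsAdmissible h₁) (hg₁ : P.IsTrajectory h₁ γ₁ g₁) (hγ₁ : 0 < γ₁)
    (hg : P.IsTrajectory (fun t => a * h₀ t + b * h₁ t) γ g) (hγ : 0 ≤ γ)
    (hinit : γ * (a * γ₁ + b * γ₀) ≤ γ₀ * γ₁) {t : ℝ} (ht : 0 ≤ t) :
    g t * (a * g₁ t + b * g₀ t) ≤ g₀ t * g₁ t := by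
  have hh := hh₀.convexComb hh₁ ha hb
  obtain ⟨ε₀, hε₀, hlow₀⟩ := hg₀.exists_pos_le hh₀ hγ₀ t
  obtain ⟨ε₁, hε₁, hlow₁⟩ := hg₁.exists_pos_le hh₁ hγ₁ t
  set ε := min ε₀ ε₁
  have hε : 0 < ε := lt_min hε₀ hε₁
  have r₀ := hg₀.hasRate hh₀
  have r₁ := hg₁.hasRate hh₁
  have r := hg.hasRate hh
  -- Concavity of the precision equation with denominators cleared: the quantity `N = g * (a * g₁ +
  -- b * g₀) - g₀ * g₁` is positive exactly when `g` exceeds the harmonic mean. Where `N > 0`, the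
  -- terms in `λ` and in the observation rates are a nonpositive multiple of `N`; only the term in
  -- `σ₂` needs the Gronwall constant.
  have hN := ((r.mul ((r₁.const_mul a).add (r₀.const_mul b))).sub (r₀.mul r₁)).nonpos
    (K := P.σ₂ ^ 2 / ε) ht (by rw [hg.zero, hg₀.zero, hg₁.zero]; linarith)
    (fun s hs hpos => ?_)
  · linarith
  have hl₀ : ε ≤ g₀ s := (min_le_left _ _).trans (hlow₀ s ⟨hs.1, hs.2.le⟩)
  have hl₁ : ε ≤ g₁ s := (min_le_right _ _).trans (hlow₁ s ⟨hs.1, hs.2.le⟩)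
  have hgs := hg.nonneg hh hγ hs.1
  have hk₀ := hh₀.nonneg s hs.1
  have hk₁ := hh₁.nonneg s hs.1
  have hq := P.precision_pos
  have hlam := P.lam_nonneg
  generalize g s = x at *
  generalize g₀ s = x₀ at *
  generalize g₁ s = x₁ at *
  generalize h₀ s = k₀ at *
  generalize h₁ s = k₁ at *
  have hx₀ : 0 < x₀ := hε.trans_le hl₀
  have hx₁ : 0 < x₁ := hε.trans_le hl₁
  obtain rfl : b = 1 - a := by linarith
  set m := a * x₁ + (1 - a) * x₀ with hm
  set N := x * m - x₀ * x₁ with hNdef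
  have hmε : ε ≤ m := by nlinarith
  have hm0 : 0 < m := hε.trans_le hmε
  have h1 : m + x - x₀ - x₁ ≤ N / ε := by
    have h2 : (m + x - x₀ - x₁) * m = N - a * (1 - a) * (x₁ - x₀) ^ 2 := by
      rw [hNdef, hm]
      ring
    have h3 : (m + x - x₀ - x₁) * m ≤ N := by
      rw [h2]
      have : 0 ≤ a * (1 - a) * (x₁ - x₀) ^ 2 := by positivity
      linarith
    calc m + x - x₀ - x₁ ≤ N / m := (le_div_iff₀ hm0).2 h3
      _ ≤ N / ε := div_le_div_of_nonneg_left hpos.le hε hmε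
  have h4 := mul_le_mul_of_nonneg_left h1 (sq_nonneg P.σ₂)
  have h5 : 0 ≤ (4 * P.lam + ((1 / P.σ₁) ^ 2 + k₀) * (a * x + x₀) +
      ((1 / P.σ₁) ^ 2 + k₁) * ((1 - a) * x + x₁)) * N := by positivity
  have h6 : P.σ₂ ^ 2 / ε * N = P.σ₂ ^ 2 * (N / ε) := by ring
  rw [h6]
  refine le_trans (le_of_eq ?_) ((sub_le_sub h4 h5).trans_eq (sub_zero _))
  rw [hNdef, hm]
  unfold drift
  ring

/-- In terms of the precision `u = 1 / γ`, the value function is convex. -/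
lemma convexOn_freeValue_inv (hc : IsInformationCost c) :
    ConvexOn ℝ (Ioi 0) (fun u => P.freeValue c u⁻¹) := by
  refine ⟨convex_Ioi 0, fun x hx y hy a b ha hb hab => ?_⟩
  simp only [smul_eq_mul]
  have hx0 : 0 < x := hx
  have hy0 : 0 < y := hy
  have hz0 : 0 < a * x + b * y := by
    have := (convex_Ioi (0 : ℝ)) hx hy ha hb hab
    simpa using this
  refine le_of_forall_pos_le_add fun ε hε => ?_
  obtain ⟨h₀, g₀, hh₀, hg₀, hc₀⟩ := exists_cost_lt (P := P) (c := c) (inv_pos.2 hx0).le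
    (lt_add_of_pos_right _ hε)
  obtain ⟨h₁, g₁, hh₁, hg₁, hc₁⟩ := exists_cost_lt (P := P) (c := c) (inv_pos.2 hy0).le
    (lt_add_of_pos_right _ hε)
  have hh := hh₀.convexComb hh₁ ha hb
  have hz := (inv_pos.2 hz0).le
  obtain ⟨g, hg⟩ := P.exists_trajectory hh hz
  obtain ⟨hi, he⟩ := comb_cost (a := a) (b := b) hc hh₀ hg₀ (inv_pos.2 hx0).le hh₁ hg₁
    (inv_pos.2 hy0).le
  have hcost : P.cost c (fun t => a * h₀ t + b * h₁ t) g ≤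
      a * P.cost c h₀ g₀ + b * P.cost c h₁ g₁ := by
    rw [he]
    refine setIntegral_mono_on (integrableOn_cost hc hh hg hz) hi measurableSet_Ioi
      fun t ht => mul_le_mul_of_nonneg_left ?_ (Real.exp_pos _).le
    have ht0 : 0 ≤ t := le_of_lt ht
    -- The trajectories start at the inverses of the precisions, so the harmonic mean inequality is
    -- an equality at time `0`.
    have h1 := mul_le_mul_of_comb ha hb hab hh₀ hg₀ (inv_pos.2 hx0) hh₁ hg₁ (inv_pos.2 hy0) hg hz
      (le_of_eq (by field_simp)) ht0
    obtain ⟨ε₀, hε₀, hlow₀⟩ := hg₀.exists_pos_le hh₀ (inv_pos.2 hx0) t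
    obtain ⟨ε₁, hε₁, hlow₁⟩ := hg₁.exists_pos_le hh₁ (inv_pos.2 hy0) t
    have hp₀ : 0 < g₀ t := hε₀.trans_le (hlow₀ t ⟨ht0, le_rfl⟩)
    have hp₁ : 0 < g₁ t := hε₁.trans_le (hlow₁ t ⟨ht0, le_rfl⟩)
    have hm : 0 < a * g₁ t + b * g₀ t := by
      have := (convex_Ioi (0 : ℝ)) hp₁ hp₀ ha hb hab
      simpa using this
    -- The weighted harmonic mean is at most the arithmetic mean.
    have h2 : g t ≤ a * g₀ t + b * g₁ t := by
      refine le_of_mul_le_mul_right (h1.trans ?_) hm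
      have h3 : 0 ≤ a * b * (g₁ t - g₀ t) ^ 2 := by positivity
      obtain rfl : b = 1 - a := by linarith
      linarith
    have h3 := hc.strictConvexOn.convexOn.2 (hh₀.nonneg t ht0) (hh₁.nonneg t ht0) ha hb hab
    simp only [smul_eq_mul] at h3
    have h4 := mul_le_mul_of_nonneg_left h2 P.aBar_pos.le
    linarith
  have h1 := freeValue_le hc hz hh hg
  have h2 := mul_le_mul_of_nonneg_left hc₀.le ha
  have h3 := mul_le_mul_of_nonneg_left hc₁.le hb
  have h4 : a * ε + b * ε = ε := by rw [← add_mul, hab, one_mul]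
  linarith

end Params

/-! ### Differentiability of the value and the bounds on the feedback. -/

/-- A function that is concave in `γ` and convex in `1 / γ` has no kinks. -/
lemma differentiableAt_of_concaveOn_of_convexOn_inv {V : ℝ → ℝ} (hV : ConcaveOn ℝ (Ici 0) V)
    (hW : ConvexOn ℝ (Ioi 0) fun u => V u⁻¹) {γ : ℝ} (hγ : 0 < γ) : DifferentiableAt ℝ V γ := by
  have hint : γ ∈ interior (Ici (0 : ℝ)) := by simpa using hγ
  have hγ' : 0 < γ⁻¹ := inv_pos.2 hγ
  have hint' : γ⁻¹ ∈ interior (Ioi (0 : ℝ)) := by simpa using hγ'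
  have hr := hV.neg.hasDerivWithinAt_rightDeriv_of_mem_interior hint
  have hl := hV.neg.hasDerivWithinAt_leftDeriv_of_mem_interior hint
  have hlr := hV.neg.leftDeriv_le_rightDeriv_of_mem_interior hint
  have hr' := hW.hasDerivWithinAt_rightDeriv_of_mem_interior hint'
  have hl' := hW.hasDerivWithinAt_leftDeriv_of_mem_interior hint'
  have hlr' := hW.leftDeriv_le_rightDeriv_of_mem_interior hint'
  generalize derivWithin (-V) (Ioi γ) γ = r at *
  generalize derivWithin (-V) (Iio γ) γ = l at *
  generalize derivWithin (fun u => V u⁻¹) (Ioi γ⁻¹) γ⁻¹ = r' at *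
  generalize derivWithin (fun u => V u⁻¹) (Iio γ⁻¹) γ⁻¹ = l' at *
  have hV' : (fun u => V u⁻¹) ∘ (fun y => y⁻¹) = V := by
    ext y
    simp
  have hinv := hasDerivAt_inv hγ.ne'
  -- Inversion reverses order on the positive axis, so the right derivative of `V` comes from the
  -- left derivative `l'` in `1 / γ`, and conversely.
  have h1 : HasDerivWithinAt V (l' * -(γ ^ 2)⁻¹) (Ioi γ) γ := by
    have h := HasDerivWithinAt.comp (h := fun y : ℝ => y⁻¹) (s := Ioi γ) γ hl'
      hinv.hasDerivWithinAt (fun y hy => inv_strictAnti₀ hγ hy)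
    rwa [hV'] at h
  have h2 : HasDerivWithinAt V (r' * -(γ ^ 2)⁻¹) (Ioo 0 γ) γ := by
    have h := HasDerivWithinAt.comp (h := fun y : ℝ => y⁻¹) (s := Ioo 0 γ) γ hr'
      hinv.hasDerivWithinAt (fun y hy => inv_strictAnti₀ hy.1 hy.2)
    rwa [hV'] at h
  have h3 : HasDerivWithinAt V (r' * -(γ ^ 2)⁻¹) (Iio γ) γ := by
    refine h2.mono_of_mem_nhdsWithin ?_
    have := Ioo_mem_nhdsLT hγ
    exact this
  have e1 : -r = l' * -(γ ^ 2)⁻¹ := by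
    have h := hr.neg
    rw [neg_neg] at h
    exact (uniqueDiffWithinAt_Ioi γ).eq_deriv _ h h1
  have e2 : -l = r' * -(γ ^ 2)⁻¹ := by
    have h := hl.neg
    rw [neg_neg] at h
    exact (uniqueDiffWithinAt_Iio γ).eq_deriv _ h h3
  have hsq : 0 < (γ ^ 2)⁻¹ := by positivity
  -- Concavity says that the right derivative of `V` is at most the left one; `l' ≤ r'`, multiplied
  -- by a negative factor, says the opposite.
  have e3 : r' * -(γ ^ 2)⁻¹ = l' * -(γ ^ 2)⁻¹ := by nlinarith
  rw [e3] at h3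
  have h4 := h3.Iic_of_Iio.union h1.Ici_of_Ioi
  rw [Iic_union_Ici, hasDerivWithinAt_univ] at h4
  exact h4.differentiableAt

namespace Params

variable {P : Params} {c : ℝ → ℝ}

lemma slope_freeValue_mem (hc : IsInformationCost c) {x y : ℝ} (hx : 0 ≤ x) (hxy : x < y) :
    slope (P.freeValue c) x y ∈ Icc 0 P.Lv := by
  rw [slope_def_field]
  have h1 := sub_pos.2 hxy
  exact ⟨div_nonneg (sub_nonneg.2 (freeValue_mono hc hx hxy.le)) h1.le,
    (div_le_iff₀ h1).2 (freeValue_sub_le hc hx hxy.le)⟩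

lemma differentiableOn_freeValue (hc : IsInformationCost c) :
    DifferentiableOn ℝ (P.freeValue c) (Ici 0) := by
  intro γ hγ
  rcases (show (0 : ℝ) ≤ γ from hγ).eq_or_lt with rfl | hpos
  -- At `0` inversion is unavailable; by concavity the slopes increase as `y ↓ 0`, and being bounded
  -- by `Lv` they converge.
  · have hanti : AntitoneOn (slope (P.freeValue c) 0) (Ioi 0) :=
      ((concaveOn_freeValue hc).slope_anti (mem_Ici.2 le_rfl)).mono
        fun y hy => ⟨mem_Ici.2 (le_of_lt hy), ne_of_gt hy⟩
    have hlim := hanti.tendsto_nhdsGT ⟨P.Lv, ?_⟩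
    · have h : HasDerivWithinAt (P.freeValue c) _ (Ioi 0) 0 :=
        (hasDerivWithinAt_iff_tendsto_slope' (lt_irrefl _)).2 hlim
      exact h.Ici_of_Ioi.differentiableWithinAt
    · rintro _ ⟨y, hy, rfl⟩
      exact (slope_freeValue_mem hc le_rfl hy).2
  · exact (differentiableAt_of_concaveOn_of_convexOn_inv (concaveOn_freeValue hc)
      (convexOn_freeValue_inv hc) hpos).differentiableWithinAt

lemma derivWithin_freeValue_mem (hc : IsInformationCost c) {γ : ℝ} (hγ : 0 ≤ γ) :
    derivWithin (P.freeValue c) (Ici 0) γ ∈ Icc 0 P.Lv := by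
  have h := (differentiableOn_freeValue (P := P) hc γ hγ).hasDerivWithinAt.mono
    (t := Ici 0) (s := Ioi γ) (fun y hy => hγ.trans (le_of_lt hy))
  have hlim := (hasDerivWithinAt_iff_tendsto_slope' self_notMem_Ioi).1 h
  exact isClosed_Icc.mem_of_tendsto hlim (eventually_mem_nhdsWithin.mono
    fun y hy => slope_freeValue_mem hc hγ hy)

lemma derivWithin_value (hc : IsInformationCost c) {γ : ℝ} (hγ : 0 ≤ γ) :
    derivWithin (P.value c) (Ici 0) γ = derivWithin (P.freeValue c) (Ici 0) γ :=
  derivWithin_congr (fun _ hx => value_eq hc hx) (value_eq hc hγ)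

lemma feedback_eq (hc : IsInformationCost c) {γ : ℝ} (hγ : 0 ≤ γ) :
    P.feedback c γ = hHat c (γ ^ 2 * derivWithin (P.freeValue c) (Ici 0) γ) := by
  rw [feedback, derivWithin_value hc hγ]

lemma feedback_le (hc : IsInformationCost c) {γ : ℝ} (hγ : 0 ≤ γ) :
    P.feedback c γ ≤ hHat c (γ ^ 2 * P.Lv) := by
  rw [feedback_eq hc hγ]
  exact hc.hHat_mono (mul_le_mul_of_nonneg_left (derivWithin_freeValue_mem hc hγ).2 (sq_nonneg γ))

end Params

/-! ### Dynamic programming and the Hamilton-Jacobi-Bellman equation. -/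

namespace Params

variable {P : Params} {c h g : ℝ → ℝ} {γ : ℝ}

lemma IsTrajectory.eq_of_eq {k f : ℝ → ℝ} (hh : IsAdmissible h) (hk : IsAdmissible k)
    (hg : P.IsTrajectory h γ g) (hf : P.IsTrajectory k γ f) (hγ : 0 ≤ γ) {T : ℝ} (hT : 0 ≤ T)
    (hhk : ∀ s ∈ Ico 0 T, h s = k s) : g T = f T :=
  le_antisymm (hg.le hh hk hf hγ le_rfl hT fun s hs => (hhk s hs).ge)
    (hf.le hk hh hg hγ le_rfl hT fun s hs => (hhk s hs).le)

lemma IsTrajectory.shift (hh : IsAdmissible h) (hg : P.IsTrajectory h γ g) {τ : ℝ} (hτ : 0 ≤ τ) :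
    P.IsTrajectory (fun t => h (t + τ)) (g τ) (fun t => g (t + τ)) := by
  refine ⟨hg.1.comp (by fun_prop) fun t ht => add_nonneg ht hτ, fun t ht => ?_⟩
  rw [intervalIntegral.integral_comp_add_right (fun s => P.drift (g s) (h s)), zero_add,
    ← (hg.hasRate hh).sub_eq hτ (add_nonneg ht hτ)]
  ring

lemma cost_eq_add_shift (hc : IsInformationCost c) (hh : IsAdmissible h)
    (hg : P.IsTrajectory h γ g) (hγ : 0 ≤ γ) {τ : ℝ} (hτ : 0 ≤ τ) :
    P.cost c h g = (∫ t in (0 : ℝ)..τ, Real.exp (-P.δ * t) * (P.aBar * g t + c (h t))) +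
      Real.exp (-P.δ * τ) * P.cost c (fun t => h (t + τ)) (fun t => g (t + τ)) := by
  have hi := integrableOn_cost hc hh hg hγ
  have h1 : ∫ t in Ioi τ, Real.exp (-P.δ * t) * (P.aBar * g t + c (h t)) =
      Real.exp (-P.δ * τ) * P.cost c (fun t => h (t + τ)) (fun t => g (t + τ)) := by
    have h2 := (measurePreserving_add_right volume τ).setIntegral_preimage_emb
      (MeasurableEquiv.addRight τ).measurableEmbedding
      (fun t => Real.exp (-P.δ * t) * (P.aBar * g t + c (h t))) (Ioi τ)
    have h3 : (fun t => t + τ) ⁻¹' Ioi τ = Ioi (0 : ℝ) := by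
      ext t
      simp
    rw [h3] at h2
    rw [← h2, cost, ← integral_const_mul]
    congr 1
    ext t
    rw [← mul_assoc, ← Real.exp_add]
    ring_nf
  rw [← h1, cost, intervalIntegral.integral_interval_add_Ioi hi
    (hi.mono_set (Ioi_subset_Ioi hτ))]

/-- The lower half of dynamic programming: the tail of a control competes in the problem started at
`g τ`. -/
lemma add_freeValue_le_cost (hc : IsInformationCost c) (hh : IsAdmissible h)
    (hg : P.IsTrajectory h γ g) (hγ : 0 ≤ γ) {τ : ℝ} (hτ : 0 ≤ τ) :
    (∫ t in (0 : ℝ)..τ, Real.exp (-P.δ * t) * (P.aBar * g t + c (h t))) +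
      Real.exp (-P.δ * τ) * P.freeValue c (g τ) ≤ P.cost c h g := by
  rw [cost_eq_add_shift hc hh hg hγ hτ]
  exact add_le_add le_rfl (mul_le_mul_of_nonneg_left
    (freeValue_le hc (hg.nonneg hh hγ hτ) (hh.shift hτ) (hg.shift hh hτ)) (Real.exp_pos _).le)

lemma intervalIntegrable_cost (hc : IsInformationCost c) (hh : IsAdmissible h)
    (hg : P.IsTrajectory h γ g) (hγ : 0 ≤ γ) {τ : ℝ} (hτ : 0 ≤ τ) :
    IntervalIntegrable (fun t => Real.exp (-P.δ * t) * (P.aBar * g t + c (h t))) volume 0 τ :=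
  (intervalIntegrable_iff_integrableOn_Ioc_of_le hτ).2
    ((integrableOn_cost hc hh hg hγ).mono_set Ioc_subset_Ioi_self)

/-- Dynamic programming: follow `h` up to time `τ`, then a near-optimal control. -/
lemma freeValue_le_add (hc : IsInformationCost c) (hh : IsAdmissible h)
    (hg : P.IsTrajectory h γ g) (hγ : 0 ≤ γ) {τ : ℝ} (hτ : 0 ≤ τ) :
    P.freeValue c γ ≤ (∫ t in (0 : ℝ)..τ, Real.exp (-P.δ * t) * (P.aBar * g t + c (h t))) +
      Real.exp (-P.δ * τ) * P.freeValue c (g τ) := by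
  have hgτ := hg.nonneg hh hγ hτ
  refine le_of_forall_pos_le_add fun ε hε => ?_
  obtain ⟨h₁, g₁, hh₁, hg₁, hlt⟩ := exists_cost_lt (P := P) (c := c) hgτ
    (lt_add_of_pos_right _ hε)
  have hk := hh.concat hh₁ τ
  obtain ⟨f, hf⟩ := P.exists_trajectory hk hγ
  have hfg : ∀ t, 0 ≤ t → t ≤ τ → f t = g t := fun t ht htτ =>
    hf.eq_of_eq hk hh hg hγ ht fun s hs => if_pos (hs.2.trans_le htτ)
  have hfτ := hf.shift hk hτ
  rw [hfg τ hτ le_rfl] at hfτ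
  have hk₁ : ∀ t, 0 ≤ t → (if t + τ < τ then h (t + τ) else h₁ (t + τ - τ)) = h₁ t := by
    intro t ht
    rw [if_neg (by linarith), add_sub_cancel_right]
  have hfg₁ : ∀ t, 0 ≤ t → f (t + τ) = g₁ t := fun t ht =>
    hfτ.eq_of_eq (hk.shift hτ) hh₁ hg₁ hgτ ht fun s hs => hk₁ s hs.1
  have hcost : P.cost c (fun t => if t + τ < τ then h (t + τ) else h₁ (t + τ - τ))
      (fun t => f (t + τ)) = P.cost c h₁ g₁ := by
    refine setIntegral_congr_fun measurableSet_Ioi fun t ht => ?_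
    have ht0 : 0 ≤ t := le_of_lt ht
    simp only [hk₁ t ht0, hfg₁ t ht0]
  have h1 := freeValue_le hc hγ hk hf
  rw [cost_eq_add_shift hc hk hf hγ hτ, hcost] at h1
  have h2 : (∫ t in (0 : ℝ)..τ, Real.exp (-P.δ * t) *
      (P.aBar * f t + c (if t < τ then h t else h₁ (t - τ)))) ≤
      ∫ t in (0 : ℝ)..τ, Real.exp (-P.δ * t) * (P.aBar * g t + c (h t)) := by
    refine intervalIntegral.integral_mono_on_of_le_Ioo hτ (intervalIntegrable_cost hc hk hf hγ hτ)
      (intervalIntegrable_cost hc hh hg hγ hτ) fun t ht => ?_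
    rw [if_pos ht.2, hfg t ht.1.le ht.2.le]
  have h3 := mul_le_mul_of_nonneg_left hlt.le (Real.exp_pos (-P.δ * τ)).le
  have h4 : Real.exp (-P.δ * τ) * ε ≤ ε := by
    refine mul_le_of_le_one_left hε.le (Real.exp_le_one_iff.2 ?_)
    have := mul_nonneg P.δ_pos.le hτ
    linarith
  linarith

lemma IsTrajectory.abs_sub_le {M : ℝ} (hh : IsAdmissible h)
    (hM : ∀ t, 0 ≤ t → h t ≤ M) (hg : P.IsTrajectory h γ g) (hγ : 0 ≤ γ) {t : ℝ} (ht : 0 ≤ t) :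
    |g t - γ| ≤ P.driftBound (max γ P.gammaInfty) M * t := by
  have h1 := (hg.hasRate hh).sub_eq le_rfl ht
  rw [hg.zero] at h1
  rw [h1, ← Real.norm_eq_abs]
  refine (intervalIntegral.norm_integral_le_of_norm_le_const
    (C := P.driftBound (max γ P.gammaInfty) M) fun s hs => ?_).trans ?_
  · rw [uIoc_of_le ht] at hs
    exact P.abs_drift_le ⟨hg.nonneg hh hγ hs.1.le,
      hg.le_of_gammaInfty_le hh (le_max_left _ _) (le_max_right _ _) hs.1.le⟩
      ⟨hh.nonneg s hs.1.le, hM s hs.1.le⟩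
  · rw [sub_zero, abs_of_nonneg ht]

lemma exists_freeValue_expansion (hc : IsInformationCost c) (hγ : 0 ≤ γ) {ε : ℝ} (hε : 0 < ε) :
    ∃ η > 0, ∀ y, 0 ≤ y → |y - γ| < η → |P.freeValue c y - P.freeValue c γ -
      derivWithin (P.freeValue c) (Ici 0) γ * (y - γ)| ≤ ε * |y - γ| := by
  have h1 := (differentiableOn_freeValue (P := P) hc γ hγ).hasDerivWithinAt
  rw [hasDerivWithinAt_iff_isLittleO] at h1
  obtain ⟨η, hη, hsub⟩ := Metric.mem_nhdsWithin_iff.1 (h1.def hε)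
  refine ⟨η, hη, fun y hy hyη => ?_⟩
  have := hsub ⟨by rwa [Metric.mem_ball, Real.dist_eq], hy⟩
  simpa [mul_comm] using this

/-- The bounds depend on the control only through `M`. This uniformity matters for the supersolution
inequality, where the near-optimal control changes with `τ`. -/
lemma abs_drift_sub_start_le {M : ℝ} (hh : IsAdmissible h) (hM0 : 0 ≤ M)
    (hM : ∀ t, 0 ≤ t → h t ≤ M) (hg : P.IsTrajectory h γ g) (hγ : 0 ≤ γ) {t τ : ℝ} (ht : 0 ≤ t)
    (htτ : t ≤ τ) :
    |g t - γ| ≤ P.driftBound (max γ P.gammaInfty) M * τ ∧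
    |P.drift (g t) (h t) - P.drift γ (h t)| ≤
      P.driftLip (max γ P.gammaInfty) M * (P.driftBound (max γ P.gammaInfty) M * τ) := by
  have hB : 0 ≤ max γ P.gammaInfty := hγ.trans (le_max_left _ _)
  have h1 : |g t - γ| ≤ P.driftBound (max γ P.gammaInfty) M * τ :=
    (hg.abs_sub_le hh hM hγ ht).trans
      (mul_le_mul_of_nonneg_left htτ (P.driftBound_nonneg hB hM0))
  refine ⟨h1, (P.abs_drift_sub_le ⟨hg.nonneg hh hγ ht,
    hg.le_of_gammaInfty_le hh (le_max_left _ _) (le_max_right _ _) ht⟩ ⟨hγ, le_max_left _ _⟩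
    ⟨hh.nonneg t ht, hM t ht⟩).trans ?_⟩
  exact mul_le_mul_of_nonneg_left h1 (P.driftLip_nonneg hB hM0)

/-- The Hamilton-Jacobi-Bellman equation, subsolution inequality. -/
lemma mul_freeValue_le (hc : IsInformationCost c) (hγ : 0 ≤ γ) {a : ℝ} (ha : 0 ≤ a) :
    P.δ * P.freeValue c γ ≤
      P.aBar * γ + c a + derivWithin (P.freeValue c) (Ici 0) γ * P.drift γ a := by
  have hh := IsAdmissible.const ha
  obtain ⟨g, hg⟩ := P.exists_trajectory hh hγ
  have hp := (derivWithin_freeValue_mem (P := P) hc hγ).1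
  have hV := freeValue_nonneg (P := P) hc hγ
  have hB : 0 ≤ max γ P.gammaInfty := hγ.trans (le_max_left _ _)
  have hest := fun {t τ : ℝ} => abs_drift_sub_start_le (t := t) (τ := τ) hh ha
    (fun _ _ => le_rfl) hg hγ
  have hC := P.driftBound_nonneg hB ha
  have hK := P.driftLip_nonneg hB ha
  generalize P.driftBound (max γ P.gammaInfty) a = C at *
  generalize P.driftLip (max γ P.gammaInfty) a = K at *
  have hexpand := fun {ε : ℝ} => exists_freeValue_expansion (P := P) (ε := ε) hc hγ
  generalize derivWithin (P.freeValue c) (Ici 0) γ = p at *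
  have haB := P.aBar_pos
  have hδ := P.δ_pos
  have hmain : ∀ ε > 0, P.δ * P.freeValue c γ ≤
      P.aBar * γ + c a + p * P.drift γ a + ε * C := by
    intro ε hε
    obtain ⟨η, hη, hη'⟩ := hexpand hε
    -- The upper bound for `δ * V` obtained from the constant control on `[0, τ]`: multiply dynamic
    -- programming by `exp (δ τ) ≥ 1 + δ τ`, expand `V (g τ)` to first order with error at most `ε *
    -- C * τ`, and divide by `τ`.
    have hlim : Tendsto (fun τ : ℝ => Real.exp (P.δ * τ) * (P.aBar * γ + P.aBar * (C * τ) + c a) +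
        p * (P.drift γ a + K * (C * τ)) + ε * C) (𝓝[>] 0)
        (𝓝 (P.aBar * γ + c a + p * P.drift γ a + ε * C)) := by
      have : Continuous fun τ : ℝ => Real.exp (P.δ * τ) *
          (P.aBar * γ + P.aBar * (C * τ) + c a) + p * (P.drift γ a + K * (C * τ)) + ε * C := by
        fun_prop
      refine (this.tendsto' 0 _ ?_).mono_left nhdsWithin_le_nhds
      simp
    have hsmall : ∀ᶠ τ : ℝ in 𝓝[>] 0, C * τ < η := by
      have : Tendsto (fun τ : ℝ => C * τ) (𝓝[>] 0) (𝓝 0) :=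
        ((continuous_const.mul continuous_id).tendsto' 0 _ (by simp)).mono_left nhdsWithin_le_nhds
      exact this.eventually_lt_const hη
    refine ge_of_tendsto hlim ?_
    filter_upwards [hsmall, self_mem_nhdsWithin] with τ hτη hτ
    have hτ0 : 0 < τ := hτ
    have h1 := freeValue_le_add hc hh hg hγ hτ0.le
    have h2 : (∫ t in (0 : ℝ)..τ, Real.exp (-P.δ * t) * (P.aBar * g t + c a)) ≤
        τ * (P.aBar * γ + P.aBar * (C * τ) + c a) := by
      calc _ ≤ ∫ _ in (0 : ℝ)..τ, (P.aBar * γ + P.aBar * (C * τ) + c a) := by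
            refine intervalIntegral.integral_mono_on_of_le_Ioo hτ0.le
              (intervalIntegrable_cost hc hh hg hγ hτ0.le) (by simp) fun t ht => ?_
            have h3 := (abs_le.1 (hest ht.1.le ht.2.le).1).2
            have h4 := runningCost_nonneg hc hh hg hγ ht.1.le
            refine (mul_le_of_le_one_left h4 (Real.exp_le_one_iff.2 ?_)).trans ?_
            · linarith [mul_nonneg hδ.le ht.1.le]
            · linarith [mul_le_mul_of_nonneg_left h3 haB.le]
        _ = _ := by rw [intervalIntegral.integral_const, smul_eq_mul, sub_zero]
    have hgτ := (hest hτ0.le le_rfl).1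
    have h5 := (abs_le.1 (hη' (g τ) (hg.nonneg hh hγ hτ0.le) (hgτ.trans_lt hτη))).2
    have h6 := mul_le_mul_of_nonneg_left hgτ hε.le
    have h7 : g τ - γ ≤ τ * (P.drift γ a + K * (C * τ)) := by
      have h8 := (hg.hasRate hh).sub_eq le_rfl hτ0.le
      rw [hg.zero] at h8
      rw [h8]
      calc _ ≤ ∫ _ in (0 : ℝ)..τ, (P.drift γ a + K * (C * τ)) := by
            refine intervalIntegral.integral_mono_on_of_le_Ioo hτ0.le
              ((hg.hasRate hh).intervalIntegrable τ hτ0.le) (by simp) fun t ht => ?_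
            linarith [(abs_le.1 (hest ht.1.le ht.2.le).2).2]
        _ = _ := by rw [intervalIntegral.integral_const, smul_eq_mul, sub_zero]
    have h9 := mul_le_mul_of_nonneg_left h7 hp
    have hE : Real.exp (P.δ * τ) * Real.exp (-P.δ * τ) = 1 := by
      rw [← Real.exp_add]
      simp
    have h10 : Real.exp (P.δ * τ) * P.freeValue c γ ≤
        Real.exp (P.δ * τ) * (τ * (P.aBar * γ + P.aBar * (C * τ) + c a)) +
          P.freeValue c (g τ) := by
      calc _ ≤ Real.exp (P.δ * τ) * (τ * (P.aBar * γ + P.aBar * (C * τ) + c a) +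
            Real.exp (-P.δ * τ) * P.freeValue c (g τ)) :=
            mul_le_mul_of_nonneg_left (by linarith) (Real.exp_pos _).le
        _ = _ := by rw [mul_add, ← mul_assoc _ (Real.exp (-P.δ * τ)), hE, one_mul]
    have h11 := mul_le_mul_of_nonneg_right (Real.add_one_le_exp (P.δ * τ)) hV
    refine le_of_mul_le_mul_left ?_ hτ0
    linarith
  refine le_of_forall_pos_le_add fun ε hε => ?_
  refine (hmain (ε / (C + 1)) (by positivity)).trans (add_le_add le_rfl ?_)
  rw [div_mul_eq_mul_div, div_le_iff₀ (by positivity)]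
  nlinarith

/-- The Hamilton-Jacobi-Bellman equation, supersolution inequality. -/
lemma le_mul_freeValue (hc : IsInformationCost c) (hγ : 0 ≤ γ) {G : ℝ}
    (hG : ∀ a, 0 ≤ a →
      G ≤ P.aBar * γ + c a + derivWithin (P.freeValue c) (Ici 0) γ * P.drift γ a) :
    G ≤ P.δ * P.freeValue c γ := by
  have hp := (derivWithin_freeValue_mem (P := P) hc hγ).1
  have hV := freeValue_nonneg (P := P) hc hγ
  have hB : 0 ≤ max γ P.gammaInfty := hγ.trans (le_max_left _ _)
  have hM0 : 0 ≤ P.hMax c (max γ P.gammaInfty) := (hc.marginalCostInv_mem _).1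
  have hest := fun {h g : ℝ → ℝ} (hh : P.IsControl c (max γ P.gammaInfty) h)
    (hg : P.IsTrajectory h γ g) {t τ : ℝ} => abs_drift_sub_start_le (t := t) (τ := τ)
    (hh.isAdmissible hc) hM0 (fun t ht => (hh.2 t ht).2) hg hγ
  -- Near-optimal controls can be taken below one fixed `hMax`, so that `C` and `K` do not change as
  -- `τ → 0`.
  have hopt := fun {a : ℝ} => exists_control_cost_lt (P := P) (a := a) hc
    (le_max_right γ P.gammaInfty) ⟨hγ, le_max_left _ _⟩
  have hC := P.driftBound_nonneg hB hM0
  have hK := P.driftLip_nonneg hB hM0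
  generalize P.driftBound (max γ P.gammaInfty) (P.hMax c (max γ P.gammaInfty)) = C at *
  generalize P.driftLip (max γ P.gammaInfty) (P.hMax c (max γ P.gammaInfty)) = K at *
  have hexpand := fun {ε : ℝ} => exists_freeValue_expansion (P := P) (ε := ε) hc hγ
  generalize derivWithin (P.freeValue c) (Ici 0) γ = p at *
  have haB := P.aBar_pos
  have hδ := P.δ_pos
  have hmain : ∀ ε > 0, G - ε * C ≤ P.δ * P.freeValue c γ := by
    intro ε hε
    obtain ⟨η, hη, hη'⟩ := hexpand hε
    have hlim : Tendsto (fun τ : ℝ => Real.exp (-P.δ * τ) *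
        (G - (P.aBar + p * K) * (C * τ) - ε * C)) (𝓝[>] 0) (𝓝 (G - ε * C)) := by
      have : Continuous fun τ : ℝ => Real.exp (-P.δ * τ) *
          (G - (P.aBar + p * K) * (C * τ) - ε * C) := by
        fun_prop
      refine (this.tendsto' 0 _ ?_).mono_left nhdsWithin_le_nhds
      simp
    have hsmall : ∀ᶠ τ : ℝ in 𝓝[>] 0, C * τ < η := by
      have : Tendsto (fun τ : ℝ => C * τ) (𝓝[>] 0) (𝓝 0) :=
        ((continuous_const.mul continuous_id).tendsto' 0 _ (by simp)).mono_left nhdsWithin_le_nhds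
      exact this.eventually_lt_const hη
    refine le_of_tendsto hlim ?_
    filter_upwards [hsmall, self_mem_nhdsWithin] with τ hτη hτ
    have hτ0 : 0 < τ := hτ
    -- The bound is proved for the cost of every near-optimal control and so passes to the infimum.
    -- Since running costs are nonnegative, the discount on `[0, τ]` may be lowered to `exp (-δ τ)`.
    have hlow : Real.exp (-P.δ * τ) * (P.freeValue c γ +
        τ * (G - (P.aBar + p * K) * (C * τ) - ε * C)) ≤ P.freeValue c γ := by
      refine le_of_forall_gt_imp_ge_of_dense fun a ha => ?_
      obtain ⟨h, g, hctrl, hg, hlt⟩ := hopt ha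
      have hh := hctrl.isAdmissible hc
      refine le_trans ?_ hlt.le
      refine le_trans ?_ (add_freeValue_le_cost hc hh hg hγ hτ0.le)
      have hgτ := (hest hctrl hg hτ0.le le_rfl).1
      have h5 := (abs_le.1 (hη' (g τ) (hg.nonneg hh hγ hτ0.le) (hgτ.trans_lt hτη))).1
      have h6 := mul_le_mul_of_nonneg_left hgτ hε.le
      have h7 : Real.exp (-P.δ * τ) * (τ * (G - (P.aBar + p * K) * (C * τ)) - p * (g τ - γ)) ≤
          ∫ t in (0 : ℝ)..τ, Real.exp (-P.δ * t) * (P.aBar * g t + c (h t)) := by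
        have h8 := (hg.hasRate hh).sub_eq le_rfl hτ0.le
        rw [hg.zero] at h8
        have hi := ((hg.hasRate hh).intervalIntegrable τ hτ0.le).const_mul p
        have hi' : IntervalIntegrable (fun _ : ℝ => G - (P.aBar + p * K) * (C * τ)) volume 0 τ := by
          simp
        calc _ = ∫ t in (0 : ℝ)..τ, Real.exp (-P.δ * τ) *
              (G - (P.aBar + p * K) * (C * τ) - p * P.drift (g t) (h t)) := by
              rw [intervalIntegral.integral_const_mul, intervalIntegral.integral_sub hi' hi,
                intervalIntegral.integral_const, intervalIntegral.integral_const_mul, ← h8,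
                smul_eq_mul, sub_zero]
          _ ≤ _ := by
              refine intervalIntegral.integral_mono_on_of_le_Ioo hτ0.le
                ((hi'.sub hi).const_mul _) (intervalIntegrable_cost hc hh hg hγ hτ0.le)
                fun t ht => ?_
              obtain ⟨e1, e2⟩ := hest hctrl hg ht.1.le ht.2.le
              have e3 := mul_le_mul_of_nonneg_left (abs_le.1 e1).1 haB.le
              have e4 := mul_le_mul_of_nonneg_left (abs_le.1 e2).1 hp
              have e5 := hG (h t) (hh.nonneg t ht.1.le)
              have e6 := runningCost_nonneg hc hh hg hγ ht.1.le
              refine le_trans (mul_le_mul_of_nonneg_left ?_ (Real.exp_pos _).le)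
                (mul_le_mul_of_nonneg_right (Real.exp_le_exp.2 ?_) e6)
              · linarith
              · linarith [mul_le_mul_of_nonneg_left ht.2.le hδ.le]
      have h9 : Real.exp (-P.δ * τ) * (P.freeValue c γ + p * (g τ - γ) - ε * (C * τ)) ≤
          Real.exp (-P.δ * τ) * P.freeValue c (g τ) :=
        mul_le_mul_of_nonneg_left (by linarith) (Real.exp_pos _).le
      linarith
    have h11 := mul_le_mul_of_nonneg_right (Real.add_one_le_exp (-P.δ * τ)) hV
    refine le_of_mul_le_mul_left ?_ hτ0
    linarith
  refine le_of_forall_pos_le_add fun ε hε => ?_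
  -- The denominator is `C + 1` because `C` may vanish.
  have h1 := hmain (ε / (C + 1)) (by positivity)
  have h2 : ε / (C + 1) * C ≤ ε := by
    rw [div_mul_eq_mul_div, div_le_iff₀ (by positivity)]
    nlinarith
  linarith

end Params

/-! ### Quadratic costs and the growth of the feedback. -/

lemma hHat_quadratic {c : ℝ → ℝ} {ζ : ℝ} (hζ : 0 < ζ) (hcζ : ∀ x, 0 ≤ x → c x = ζ * x ^ 2) {x : ℝ}
    (hx : 0 ≤ x) : hHat c x = x / (2 * ζ) := by
  have hset : {h : ℝ | 0 ≤ h ∧ IsMaxOn (fun y => y * x - c y) (Ici 0) h} = {x / (2 * ζ)} := by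
    have hid : ∀ y, 0 ≤ y → y * x - c y = x ^ 2 / (4 * ζ) - ζ * (y - x / (2 * ζ)) ^ 2 := by
      intro y hy
      rw [hcζ y hy]
      field_simp
      ring
    have h0 : 0 ≤ x / (2 * ζ) := by positivity
    ext h
    simp only [mem_ofPred_eq, mem_singleton_iff]
    constructor
    · rintro ⟨hh, hmax⟩
      have h1 : x / (2 * ζ) * x - c (x / (2 * ζ)) ≤ h * x - c h := hmax h0
      rw [hid _ h0, hid _ hh] at h1
      have h2 : (h - x / (2 * ζ)) ^ 2 = 0 := by nlinarith [sq_nonneg (h - x / (2 * ζ))]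
      linarith [pow_eq_zero_iff (two_ne_zero) |>.1 h2]
    · rintro rfl
      refine ⟨h0, fun y hy => ?_⟩
      have h1 := mul_nonneg hζ.le (sq_nonneg (y - x / (2 * ζ)))
      simp only [mem_ofPred_eq]
      rw [hid y hy, hid _ h0]
      linarith [mul_nonneg hζ.le (sq_nonneg (x / (2 * ζ) - x / (2 * ζ)))]
  rw [hHat, hset, csSup_singleton]

namespace Params

variable {P : Params} {c : ℝ → ℝ} {ζ : ℝ}

/-- The Hamilton-Jacobi-Bellman equation for quadratic costs. -/
lemma mul_freeValue_eq_of_quadratic (hc : IsInformationCost c) (hζ : 0 < ζ)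
    (hcζ : ∀ x, 0 ≤ x → c x = ζ * x ^ 2) {γ : ℝ} (hγ : 0 ≤ γ) :
    P.δ * P.freeValue c γ = P.aBar * γ + derivWithin (P.freeValue c) (Ici 0) γ * P.drift γ 0 -
      (γ ^ 2 * derivWithin (P.freeValue c) (Ici 0) γ) ^ 2 / (4 * ζ) := by
  have hp := (derivWithin_freeValue_mem (P := P) hc hγ).1
  have h1 := fun {a : ℝ} => mul_freeValue_le (P := P) (a := a) hc hγ
  have h2 := fun {G : ℝ} => le_mul_freeValue (P := P) (G := G) hc hγ
  generalize derivWithin (P.freeValue c) (Ici 0) γ = p at *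
  -- Completing the square in `a`; the minimizer `γ ^ 2 * p / (2 * ζ)` is nonnegative, hence
  -- allowed, and there the two inequalities meet.
  have hid : ∀ a, 0 ≤ a → P.aBar * γ + c a + p * P.drift γ a =
      P.aBar * γ + p * P.drift γ 0 - (γ ^ 2 * p) ^ 2 / (4 * ζ) +
        ζ * (a - γ ^ 2 * p / (2 * ζ)) ^ 2 := by
    intro a ha
    rw [hcζ a ha]
    unfold drift
    field_simp
    ring
  apply le_antisymm
  · have ha : 0 ≤ γ ^ 2 * p / (2 * ζ) := by positivity
    refine (h1 ha).trans (le_of_eq ?_)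
    rw [hid _ ha]
    ring
  · refine h2 fun a ha => ?_
    rw [hid a ha]
    linarith [mul_nonneg hζ.le (sq_nonneg (a - γ ^ 2 * p / (2 * ζ)))]

lemma tendsto_feedback_of_quadratic (hc : IsInformationCost c) (hζ : 0 < ζ)
    (hcζ : ∀ x, 0 ≤ x → c x = ζ * x ^ 2) :
    Tendsto (fun γ : ℝ => P.feedback c γ / γ ^ (1 / 2 : ℝ)) atTop (𝓝 (√P.aBar / √ζ)) := by
  set p := fun γ => derivWithin (P.freeValue c) (Ici 0) γ
  have hp : ∀ γ, 0 ≤ γ → p γ ∈ Icc 0 P.Lv := fun γ hγ => derivWithin_freeValue_mem hc hγ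
  have hV : ∀ γ, 0 ≤ γ → 0 ≤ P.freeValue c γ := fun γ hγ => freeValue_nonneg hc hγ
  have haB := P.aBar_pos
  have hδ := P.δ_pos
  have hlam := P.lam_nonneg
  have hq := P.precision_pos
  -- The Hamilton-Jacobi-Bellman equation divided by `γ` and solved for the quadratic term, whose
  -- limit is sought.
  have heq : ∀ γ, 0 < γ → γ * (γ * p γ) ^ 2 / (4 * ζ) = P.aBar - (1 / P.σ₁) ^ 2 * (γ * p γ) -
      2 * P.lam * p γ + P.σ₂ ^ 2 * (p γ / γ) - P.δ * (P.freeValue c γ / γ) := by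
    intro γ hγ
    have h1 := mul_freeValue_eq_of_quadratic (P := P) hc hζ hcζ hγ.le
    change P.δ * P.freeValue c γ = P.aBar * γ + p γ * P.drift γ 0 -
      (γ ^ 2 * p γ) ^ 2 / (4 * ζ) at h1
    rw [← mul_div_assoc P.δ, h1]
    unfold drift
    field_simp
    ring
  -- For `γ ≥ 1` the right side of `heq` is at most `aBar + σ₂² * Lv`, so `(γ * p γ) ^ 2 ≤ D / γ`.
  have hγp : Tendsto (fun γ => γ * p γ) atTop (𝓝 0) := by
    set D := 4 * ζ * (P.aBar + P.σ₂ ^ 2 * P.Lv)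
    have hlim : Tendsto (fun γ : ℝ => √(D / γ)) atTop (𝓝 0) := by
      have : Tendsto (fun γ : ℝ => D / γ) atTop (𝓝 0) := tendsto_const_nhds.div_atTop tendsto_id
      simpa [Function.comp_def] using (Real.continuous_sqrt.tendsto 0).comp this
    refine tendsto_of_tendsto_of_tendsto_of_le_of_le' tendsto_const_nhds hlim ?_ ?_
    · filter_upwards [eventually_ge_atTop 0] with γ hγ
      exact mul_nonneg hγ (hp γ hγ).1
    · filter_upwards [eventually_ge_atTop 1] with γ hγ
      have hγ0 : 0 < γ := by linarith
      refine Real.le_sqrt_of_sq_le ?_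
      rw [le_div_iff₀ hγ0]
      have h1 := heq γ hγ0
      have h2 := (hp γ hγ0.le).1
      have h3 : p γ / γ ≤ P.Lv := (div_le_self h2 hγ).trans (hp γ hγ0.le).2
      have h4 := mul_le_mul_of_nonneg_left h3 (sq_nonneg P.σ₂)
      have h5 : 0 ≤ (1 / P.σ₁) ^ 2 * (γ * p γ) := by positivity
      have h6 : 0 ≤ 2 * P.lam * p γ := by positivity
      have h7 : 0 ≤ P.δ * (P.freeValue c γ / γ) :=
        mul_nonneg hδ.le (div_nonneg (hV γ hγ0.le) hγ0.le)
      have h8 : γ * (γ * p γ) ^ 2 / (4 * ζ) ≤ P.aBar + P.σ₂ ^ 2 * P.Lv := by linarith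
      rw [div_le_iff₀ (by positivity)] at h8
      linarith
  have hp0 : Tendsto p atTop (𝓝 0) := by
    refine tendsto_of_tendsto_of_tendsto_of_le_of_le' tendsto_const_nhds hγp ?_ ?_
    · filter_upwards [eventually_ge_atTop 0] with γ hγ using (hp γ hγ).1
    · filter_upwards [eventually_ge_atTop 1] with γ hγ
      exact le_mul_of_one_le_left (hp γ (by linarith)).1 hγ
  have hpγ : Tendsto (fun γ => p γ / γ) atTop (𝓝 0) := hp0.div_atTop tendsto_id
  -- A concave function lies below its tangent at `γ₀`; choosing `p γ₀ < a / 2` and then `γ` large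
  -- keeps `V / γ` below `a`.
  have hVγ : Tendsto (fun γ => P.freeValue c γ / γ) atTop (𝓝 0) := by
    refine tendsto_order.2 ⟨fun a ha => ?_, fun a ha => ?_⟩
    · filter_upwards [eventually_ge_atTop 0] with γ hγ
      exact ha.trans_le (div_nonneg (hV γ hγ) hγ)
    · obtain ⟨γ₀, hγ₀p, hγ₀⟩ := ((hp0.eventually_lt_const (half_pos ha)).and
        (eventually_gt_atTop 0)).exists
      have hlim : Tendsto (fun γ : ℝ => P.freeValue c γ₀ / γ) atTop (𝓝 0) :=
        tendsto_const_nhds.div_atTop tendsto_id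
      filter_upwards [hlim.eventually_lt_const (half_pos ha), eventually_gt_atTop γ₀] with γ h1 h2
      have hγ : 0 < γ := hγ₀.trans h2
      have h3 := (concaveOn_freeValue (P := P) hc).slope_le_derivWithin (mem_Ici.2 hγ₀.le)
        (mem_Ici.2 hγ.le) h2 (differentiableOn_freeValue hc γ₀ hγ₀.le)
      change _ ≤ p γ₀ at h3
      rw [slope_def_field, div_le_iff₀ (sub_pos.2 h2)] at h3
      rw [div_lt_iff₀ hγ] at h1 ⊢
      have h4 := (hp γ₀ hγ₀.le).1
      nlinarith
  have hsq : Tendsto (fun γ => γ * (γ * p γ) ^ 2 / (4 * ζ)) atTop (𝓝 P.aBar) := by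
    have h1 : Tendsto (fun γ => P.aBar - (1 / P.σ₁) ^ 2 * (γ * p γ) - 2 * P.lam * p γ +
        P.σ₂ ^ 2 * (p γ / γ) - P.δ * (P.freeValue c γ / γ)) atTop
        (𝓝 (P.aBar - (1 / P.σ₁) ^ 2 * 0 - 2 * P.lam * 0 + P.σ₂ ^ 2 * 0 - P.δ * 0)) :=
      (((tendsto_const_nhds.sub (hγp.const_mul _)).sub (hp0.const_mul _)).add
        (hpγ.const_mul _)).sub (hVγ.const_mul _)
    simp only [mul_zero, sub_zero, add_zero] at h1
    refine h1.congr' ?_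
    filter_upwards [eventually_gt_atTop 0] with γ hγ using (heq γ hγ).symm
  have hroot := ((Real.continuous_sqrt.tendsto _).comp hsq).div_const √ζ
  refine hroot.congr' ?_
  filter_upwards [eventually_gt_atTop 0] with γ hγ
  have hp1 := (hp γ hγ.le).1
  have hfb : P.feedback c γ = γ ^ 2 * p γ / (2 * ζ) := by
    rw [feedback_eq hc hγ.le, hHat_quadratic hζ hcζ (mul_nonneg (sq_nonneg γ) hp1)]
  have hs : 0 < √γ := Real.sqrt_pos.2 hγ
  have hsζ : 0 < √ζ := Real.sqrt_pos.2 hζ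
  -- The square root of the left side of `heq`, divided by `√ζ`, is exactly `feedback / √γ`, because
  -- the feedback is `γ ^ 2 * p γ / (2 * ζ)`.
  have h1 : γ * (γ * p γ) ^ 2 / (4 * ζ) = (√γ * (γ * p γ) / (2 * √ζ)) ^ 2 := by
    rw [div_pow, mul_pow √γ, mul_pow 2, Real.sq_sqrt hγ.le, Real.sq_sqrt hζ.le]
    norm_num
  rw [Function.comp_apply, h1, Real.sqrt_sq (by positivity), hfb, ← Real.sqrt_eq_rpow]
  have h2 : γ = √γ ^ 2 := (Real.sq_sqrt hγ.le).symm
  have h3 : ζ = √ζ ^ 2 := (Real.sq_sqrt hζ.le).symm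
  generalize p γ = x
  rw [div_div, div_div, div_eq_div_iff (by positivity) (by positivity)]
  generalize √γ = s at *
  generalize √ζ = z at *
  rw [h2, h3]
  ring

end Params
end InfoAcq

end

/-! ### The main theorem. -/

theorem mainTheorem6 (P : InfoAcq.Params) (c : ℝ → ℝ) (hc : InfoAcq.IsInformationCost c) :
    (∀ γmax, P.gammaInfty < γmax → ∀ γ ∈ Set.Icc 0 γmax,
        P.value c γ = P.reducedValue c γmax γ) ∧
    DifferentiableOn ℝ (P.value c) (Set.Ici 0) ∧
    (∀ γ : ℝ, 0 ≤ γ →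
        0 ≤ P.feedback c γ ∧
        P.feedback c γ ≤ InfoAcq.hHat c (γ ^ 2 * P.Lv) ∧
        InfoAcq.hHat c (γ ^ 2 * P.Lv) ≤ InfoAcq.marginalCostInv c (γ ^ 2 * P.Lv)) ∧
    (∀ ζ : ℝ, 0 < ζ → (∀ x : ℝ, 0 ≤ x → c x = ζ * x ^ 2) →
        Filter.Tendsto (fun γ : ℝ => P.feedback c γ / γ ^ (1 / 2 : ℝ)) Filter.atTop
          (nhds (√P.aBar / √ζ))) :=
  ⟨fun γmax hmax γ hγ => by
      rw [InfoAcq.Params.value_eq hc hγ.1, InfoAcq.Params.reducedValue_eq hc hmax.le hγ],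
    (InfoAcq.Params.differentiableOn_freeValue hc).congr fun γ hγ =>
      InfoAcq.Params.value_eq hc hγ,
    fun γ hγ => ⟨InfoAcq.hHat_nonneg _ _, InfoAcq.Params.feedback_le hc hγ,
      hc.hHat_le_marginalCostInv _⟩,
    fun ζ hζ hcζ => InfoAcq.Params.tendsto_feedback_of_quadratic hc hζ hcζ⟩
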